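/- Let $\mathcal X,\mathcal Y$ be finite non-empty sets and let $W(x,y|x',y')$ be an irreducible and ergodic (aperiodic) transition matrix on $\mathcal X\times\mathcal Y$, so that $\sum_{x,y}W(x,y|x',y')=1$. Call $W$ *non-hidden* if $W(y|y'):=\sum_x W(x,y|x',y')$ does not depend on $x'$ (for all $y,y'$), and *strongly non-hidden* if for every $\theta>-1$ and all $y,y'$ the sum $W_\theta(y|y'):=\sum_x W(x,y|x',y')^{1+\theta}$ does not depend on $x'$. Write $\rho(A)$ for the Perron–Frobenius eigenvalue (spectral radius) of a non-negative matrix $A$; matrix entries below are read as $0$ where $W(x,y|x',y')=0$, respectively $W(y|y')=0$. For non-hidden $W$ and $\theta\in(-1,0)\cup(0,\infty)$ put $$H^{\downarrow,W}_{1+\theta}(X|Y):=-\tfrac1\theta\log\rho\big(W(x,y|x',y')^{1+\theta}W(y|y')^{-\theta}\big),$$ extended to $\theta=0$ and $\theta=-1$ by taking limits, let $H^W(X|Y):=H^{\downarrow,W}_1(X|Y)$, and $$\mathsf V^W(X|Y):=\lim_{\theta\to0}\frac{2\,[H^W(X|Y)-H^{\downarrow,W}_{1+\theta}(X|Y)]}{\theta}.$$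 For strongly non-hidden $W$ put $$H^{\uparrow,W}_{1+\theta}(X|Y):=-\tfrac{1+\theta}{\theta}\log\rho\big(W_\theta(y|y')^{1/(1+\theta)}\big)\qquad(\theta\in(-1,0)\cup(0,\infty)),$$ extended to $\theta=0$ and $\theta=-1$ by taking limits, and, for $\theta,\theta'>-1$, $$H^{W}_{1+\theta,1+\theta'}(X|Y):=-\tfrac1\theta\log\rho\big(W_\theta(y|y')\,W_{\theta'}(y|y')^{-\theta/(1+\theta')}\big)+\tfrac{\theta'}{1+\theta'}H^{\uparrow,W}_{1+\theta'}(X|Y),$$ extended to $\theta=0$ by taking the limit in $\theta$. If $W$ is non-hidden, then the limits defining $H^{\downarrow,W}_1$, $H^{\downarrow,W}_0$ and $\mathsf V^W(X|Y)$ exist, and: 1. $\theta\mapsto\theta H^{\downarrow,W}_{1+\theta}(X|Y)$ is concave on $[-1,\infty)$, and it is strictly concave iff $\mathsf V^W(X|Y)>0$. 2. $\theta\mapsto H^{\downarrow,W}_{1+\theta}(X|Y)$ is non-increasing on $[-1,\infty)$, and it is strictly decreasing iff $\mathsf V^W(X|Y)>0$. If $W$ is strongly non-hidden, then the limits defining $H^{\uparrow,W}_1$,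 $H^{\uparrow,W}_0$ and $H^W_{1,1+\theta'}$ also exist, and: 3. $\theta\mapsto\theta H^{\uparrow,W}_{1+\theta}(X|Y)$ is concave on $[-1,\infty)$, and it is strictly concave iff $\mathsf V^W(X|Y)>0$. 4. $\theta\mapsto H^{\uparrow,W}_{1+\theta}(X|Y)$ is non-increasing on $[-1,\infty)$, and it is strictly decreasing iff $\mathsf V^W(X|Y)>0$. 5. $H^{\downarrow,W}_{1+\theta}(X|Y)\le H^{\uparrow,W}_{1+\theta}(X|Y)$ for every $\theta\in(-1,0)\cup(0,\infty)$. 6. For every fixed $\theta'>-1$, $\theta\mapsto\theta H^{W}_{1+\theta,1+\theta'}(X|Y)$ is concave on $(-1,\infty)$, and it is strictly concave iff $\mathsf V^W(X|Y)>0$. 7. For every fixed $\theta'>-1$, $\theta\mapsto H^{W}_{1+\theta,1+\theta'}(X|Y)$ is non-increasing on $(-1,\infty)$, and it is strictly decreasing iff $\mathsf V^W(X|Y)>0$. 8. $H^{W}_{1+\theta,1}(X|Y)=H^{\downarrow,W}_{1+\theta}(X|Y)$ for every $\theta>-1$. 9. $H^{W}_{1+\theta,1+\theta}(X|Y)=H^{\uparrow,W}_{1+\theta}(X|Y)$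 for every $\theta>-1$. 10. For every $\theta\in(-1,0)\cup(0,\infty)$, the function $\theta'\mapsto H^{W}_{1+\theta,1+\theta'}(X|Y)$ on $(-1,\infty)$ attains its maximum at $\theta'=\theta$, and it is differentiable there with $$\frac{d\,H^{W}_{1+\theta,1+\theta'}(X|Y)}{d\theta'}\bigg|_{\theta'=\theta}=0.$$ -/

import Mathlib

open Set Filter Topology

namespace MarkovRenyi

noncomputable section

/-- The Perron-Frobenius eigenvalue of an entrywise nonnegative matrix: its spectral radius,
that is, the largest modulus of a complex eigenvalue. -/
def pfEigenvalue {n : Type*} [Fintype n] [DecidableEq n] (A : Matrix n n ℝ) : ℝ :=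
  (spectralRadius ℂ (A.map (algebraMap ℝ ℂ))).toReal

/-- Ergodicity of an irreducible transition matrix, i.e. aperiodicity: the possible return times
to any given state have no common divisor other than `1`. -/
def IsErgodic {n : Type*} [Fintype n] [DecidableEq n] (A : Matrix n n ℝ) : Prop :=
  ∀ s : n, ∀ d : ℕ, (∀ k : ℕ, 0 < k → 0 < (A ^ k) s s → d ∣ k) → d = 1

variable {X Y : Type*} [Fintype X] [DecidableEq X] [Fintype Y] [DecidableEq Y]

/- Throughout, the entry `W (x, y) (x', y')` is the probability `W(x, y | x', y')` of going from
`(x', y')` to `(x, y)`; a transition matrix is thus column-stochastic. -/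

/-- `W` is non-hidden with respect to `Y`: `∑ x, W(x, y | x', y')` does not depend on `x'`. -/
def NonHidden (W : Matrix (X × Y) (X × Y) ℝ) : Prop :=
  ∀ (y y' : Y) (x₁ x₂ : X), ∑ x, W (x, y) (x₁, y') = ∑ x, W (x, y) (x₂, y')

/-- `W` is strongly non-hidden with respect to `Y`: for every `θ > -1`,
`∑ x, W(x, y | x', y') ^ (1 + θ)` does not depend on `x'`. -/
def StronglyNonHidden (W : Matrix (X × Y) (X × Y) ℝ) : Prop :=
  ∀ θ : ℝ, -1 < θ → ∀ (y y' : Y) (x₁ x₂ : X),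
    ∑ x, W (x, y) (x₁, y') ^ (1 + θ) = ∑ x, W (x, y) (x₂, y') ^ (1 + θ)

variable [Nonempty X]

/-- `W(y | y')`; for non-hidden `W` the choice of `x'` is irrelevant. -/
def marginal (W : Matrix (X × Y) (X × Y) ℝ) : Matrix Y Y ℝ :=
  Matrix.of fun y y' => ∑ x, W (x, y) (Classical.arbitrary X, y')

/-- `W_θ(y | y')`; for strongly non-hidden `W` and `θ > -1` the choice of `x'` is irrelevant. -/
def powerMarginal (W : Matrix (X × Y) (X × Y) ℝ) (θ : ℝ) : Matrix Y Y ℝ :=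
  Matrix.of fun y y' => ∑ x, W (x, y) (Classical.arbitrary X, y') ^ (1 + θ)

/-- The tilted matrix `W(x, y | x', y') ^ (1 + θ) * W(y | y') ^ (-θ)`. For `θ > -1` its entry
is `0` wherever `W(x, y | x', y') = 0`. -/
def tilted (W : Matrix (X × Y) (X × Y) ℝ) (θ : ℝ) : Matrix (X × Y) (X × Y) ℝ :=
  Matrix.of fun s s' => W s s' ^ (1 + θ) * marginal W s.2 s'.2 ^ (-θ)

/-- `K_θ(y | y') = W_θ(y | y') ^ (1 / (1 + θ))`. -/
def kMatrix (W : Matrix (X × Y) (X × Y) ℝ) (θ : ℝ) : Matrix Y Y ℝ :=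
  Matrix.of fun y y' => powerMarginal W θ y y' ^ (1 / (1 + θ))

/-- `N_{θ,θ'}(y | y') = W_θ(y | y') * W_θ'(y | y') ^ (-θ / (1 + θ'))`. -/
def nMatrix (W : Matrix (X × Y) (X × Y) ℝ) (θ θ' : ℝ) : Matrix Y Y ℝ :=
  Matrix.of fun y y' => powerMarginal W θ y y' * powerMarginal W θ' y y' ^ (-θ / (1 + θ'))

/-- The lower conditional Rényi entropy of order `1 + θ` for `W`, for `θ ≥ -1`;
at `θ = 0` and `θ = -1` it is defined by taking the limit. -/
def lowerEntropy (W : Matrix (X × Y) (X × Y) ℝ) (θ : ℝ) : ℝ :=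
  let f : ℝ → ℝ := fun t => -(1 / t) * Real.log (pfEigenvalue (tilted W t))
  if θ = 0 then limUnder (𝓝[≠] 0) f
  else if θ = -1 then limUnder (𝓝[>] (-1)) f
  else f θ

/-- The conditional entropy for `W`. -/
def condEntropy (W : Matrix (X × Y) (X × Y) ℝ) : ℝ := lowerEntropy W 0

/-- The difference quotient whose limit at `θ → 0` is the conditional variance for `W`. -/
def varianceQuotient (W : Matrix (X × Y) (X × Y) ℝ) (θ : ℝ) : ℝ :=
  2 * (condEntropy W - lowerEntropy W θ) / θ

/-- The conditional variance `V^W(X|Y)` for `W`. -/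
def condVariance (W : Matrix (X × Y) (X × Y) ℝ) : ℝ :=
  limUnder (𝓝[≠] 0) (varianceQuotient W)

/-- The upper conditional Rényi entropy of order `1 + θ` for `W`, for `θ ≥ -1`;
at `θ = 0` and `θ = -1` it is defined by taking the limit. -/
def upperEntropy (W : Matrix (X × Y) (X × Y) ℝ) (θ : ℝ) : ℝ :=
  let f : ℝ → ℝ := fun t => -((1 + t) / t) * Real.log (pfEigenvalue (kMatrix W t))
  if θ = 0 then limUnder (𝓝[≠] 0) f
  else if θ = -1 then limUnder (𝓝[>] (-1)) f
  else f θ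

/-- The two-parameter conditional Rényi entropy of orders `1 + θ`, `1 + θ'` for `W`, for
`θ, θ' > -1`; at `θ = 0` it is defined by taking the limit in `θ`. -/
def twoParamEntropy (W : Matrix (X × Y) (X × Y) ℝ) (θ θ' : ℝ) : ℝ :=
  let f : ℝ → ℝ := fun t =>
    -(1 / t) * Real.log (pfEigenvalue (nMatrix W t θ')) + θ' / (1 + θ') * upperEntropy W θ'
  if θ = 0 then limUnder (𝓝[≠] 0) f else f θ

end

end MarkovRenyi

/-!
For irreducible matrices, `A i j ≤ B i j ^ a * C i j ^ b` with `a + b = 1` gives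
`ρ(A) ≤ ρ(B) ^ a * ρ(C) ^ b`, by weighted AM-GM against the Perron eigenvectors. Hence
`log ρ(W_ij ^ (1 + θ) * M_ij ^ (-θ))` is convex in `θ`, where `M` is the marginal, and it is affine
exactly when the increment `log W_ij - log M_ij` is a constant plus a coboundary `g i - g j`. The
second-order expansion of `ρ` at `θ = 0` expresses the variance as a sum of squares that vanishes
exactly in this case, so that `V > 0` is equivalent to strict convexity. Concavity of `θ H` and
monotonicity of `H` follow, since `-H` is the slope at `0` of a convex function vanishing there.

In the strongly non-hidden case, `(x, y) ↦ y` carries the tilted matrix to `N_{θ,0}` with the same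
eigenvalue, and the coboundary can be chosen to depend on `y` only, whence the same dichotomy for
the matrices `K` and `N`. Finally, `N_{θ,θ'} = K_θ ^ (1 + θ) * K_θ' ^ (-θ)` entrywise, and the
inequality above, read for `N` when `θ < 0` and for `K_θ` when `θ > 0`, shows that `θ' = θ` is a
maximum.
-/

namespace MarkovRenyi

section PerronFrobenius

open Matrix

variable {m n : Type*} {A B : Matrix n n ℝ}

lemma isIrreducible_of_map {B : Matrix m m ℝ} {π : n → m} (hπ : π.Surjective)
    (hA : A.IsIrreducible) (hB : ∀ i j, 0 ≤ B i j) (h : ∀ i j, 0 < A i j → 0 < B (π i) (π j)) :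
    B.IsIrreducible := by
  refine ⟨hB, fun i j => ?_⟩
  obtain ⟨i, rfl⟩ := hπ i
  obtain ⟨j, rfl⟩ := hπ j
  obtain ⟨p, hp⟩ := hA.connected i j
  let := toQuiver A
  let := toQuiver B
  let F : n ⥤q m := ⟨π, fun e => ⟨h _ _ e.down⟩⟩
  refine ⟨F.mapPath p, ?_⟩
  cases p with
  | nil => exact absurd hp (lt_irrefl 0)
  | cons q e => exact Nat.succ_pos _

lemma isIrreducible_of_pos (hA : A.IsIrreducible) (hB : ∀ i j, 0 ≤ B i j)
    (h : ∀ i j, 0 < A i j → 0 < B i j) : B.IsIrreducible :=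
  isIrreducible_of_map Function.surjective_id hA hB h

variable [Fintype n]

lemma mulVec_apply_pos (hB : ∀ i j, 0 ≤ B i j) {v : n → ℝ} (hv : ∀ i, 0 ≤ v i) {i j : n}
    (hij : 0 < B i j) (hj : 0 < v j) : 0 < (B *ᵥ v) i :=
  Finset.sum_pos' (fun k _ => mul_nonneg (hB i k) (hv k)) ⟨j, Finset.mem_univ j, mul_pos hij hj⟩

lemma dotProduct_pos [Nonempty n] {u v : n → ℝ} (hu : ∀ i, 0 < u i) (hv : ∀ i, 0 < v i) :
    0 < u ⬝ᵥ v :=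
  Finset.sum_pos (fun i _ => mul_pos (hu i) (hv i)) Finset.univ_nonempty

lemma le_sum_of_smul_le_mulVec (hA : ∀ i j, 0 ≤ A i j) {r : ℝ} {x : n → ℝ}
    (hx : x ∈ stdSimplex ℝ n) (h : ∀ i, r * x i ≤ (A *ᵥ x) i) : r ≤ ∑ i, ∑ j, A i j :=
  calc r = ∑ i, r * x i := by rw [← Finset.mul_sum, hx.2, mul_one]
    _ ≤ ∑ i, ∑ j, A i j * x j := Finset.sum_le_sum fun i _ => h i
    _ ≤ ∑ i, ∑ j, A i j := Finset.sum_le_sum fun i _ => Finset.sum_le_sum fun j _ =>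
        mul_le_of_le_one_right (hA i j) (mem_Icc_of_mem_stdSimplex hx j).2

/-- The pairs `(r, x)` with `r ≥ 0` and `x` a probability vector such that `r x ≤ A x`; the
largest such `r` is the Perron-Frobenius eigenvalue. -/
def collatzWielandtSet (A : Matrix n n ℝ) : Set (ℝ × (n → ℝ)) :=
  {p | 0 ≤ p.1 ∧ p.2 ∈ stdSimplex ℝ n ∧ ∀ i, p.1 * p.2 i ≤ (A *ᵥ p.2) i}

lemma isCompact_collatzWielandtSet (hA : ∀ i j, 0 ≤ A i j) :
    IsCompact (collatzWielandtSet A) := by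
  have hclosed : IsClosed {p : ℝ × (n → ℝ) | ∀ i, p.1 * p.2 i ≤ (A *ᵥ p.2) i} := by
    simp only [Set.ofPred_forall]
    exact isClosed_iInter fun i => isClosed_le (by fun_prop) (by unfold mulVec dotProduct; fun_prop)
  refine ((isCompact_Icc (a := 0) (b := ∑ i, ∑ j, A i j)).prod
    (isCompact_stdSimplex ℝ n)).inter_right hclosed |>.of_isClosed_subset ?_ ?_
  · exact (isClosed_Ici.preimage continuous_fst).inter
      (((isClosed_stdSimplex ℝ n).preimage continuous_snd).inter hclosed)
  · exact fun p ⟨hp, hx, h⟩ => ⟨⟨⟨hp, le_sum_of_smul_le_mulVec hA hx h⟩, hx⟩, h⟩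

lemma exists_mem_collatzWielandtSet_of_lt [Nonempty n] {r : ℝ} {w : n → ℝ} (hr : 0 ≤ r)
    (hw : ∀ i, 0 < w i) (h : ∀ i, r * w i < (A *ᵥ w) i) :
    ∃ p ∈ collatzWielandtSet A, r < p.1 := by
  obtain ⟨i₀, hi₀⟩ := Finite.exists_min fun i => (A *ᵥ w) i / w i
  have hs : 0 < ∑ i, w i := Finset.sum_pos (fun i _ => hw i) Finset.univ_nonempty
  have hlt : r < (A *ᵥ w) i₀ / w i₀ := (lt_div_iff₀ (hw i₀)).2 (h i₀)
  refine ⟨((A *ᵥ w) i₀ / w i₀, (∑ i, w i)⁻¹ • w), ⟨hr.trans hlt.le, ⟨fun i => ?_, ?_⟩,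
    fun i => ?_⟩, hlt⟩
  · exact mul_nonneg (inv_nonneg.2 hs.le) (hw i).le
  · simp only [Pi.smul_apply, smul_eq_mul, ← Finset.mul_sum]
    exact inv_mul_cancel₀ hs.ne'
  · simp only [mulVec_smul, Pi.smul_apply, smul_eq_mul]
    rw [mul_left_comm]
    exact mul_le_mul_of_nonneg_left ((le_div_iff₀ (hw i)).1 (hi₀ i)) (inv_nonneg.2 hs.le)

lemma pow_apply_nonneg [DecidableEq n] (hA : ∀ i j, 0 ≤ A i j) (k : ℕ) (i j : n) :
    0 ≤ (A ^ k) i j := by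
  induction k generalizing j with
  | zero =>
    rw [pow_zero, one_apply]
    split_ifs <;> norm_num
  | succ k ih =>
    rw [pow_succ, mul_apply]
    exact Finset.sum_nonneg fun l _ => mul_nonneg (ih l) (hA l j)

lemma pow_mulVec_eq [DecidableEq n] {v : n → ℝ} {r : ℝ} (h : A *ᵥ v = r • v) (k : ℕ) :
    A ^ k *ᵥ v = r ^ k • v := by
  induction k with
  | zero => simp
  | succ k ih => rw [pow_succ, ← mulVec_mulVec, h, mulVec_smul, ih, smul_smul, pow_succ, mul_comm]

lemma exists_pow_apply_pos [DecidableEq n] (hA : A.IsIrreducible) (i j : n) :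
    ∃ k > 0, 0 < (A ^ k) i j :=
  (isIrreducible_iff_exists_pow_pos hA.nonneg).1 hA i j

lemma exists_pos_commute (hA : A.IsIrreducible) :
    ∃ B : Matrix n n ℝ, (∀ i j, 0 < B i j) ∧ Commute A B := by
  classical
  choose k _ hk using exists_pow_apply_pos hA
  refine ⟨∑ p : n × n, A ^ k p.1 p.2, fun i j => ?_,
    Commute.sum_right _ _ _ fun p _ => Commute.pow_right rfl _⟩
  rw [Matrix.sum_apply]
  exact Finset.sum_pos' (fun p _ => pow_apply_nonneg hA.nonneg _ _ _)
    ⟨(i, j), Finset.mem_univ _, hk i j⟩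

lemma pos_of_mulVec_eq (hA : A.IsIrreducible) {v : n → ℝ} {r : ℝ} (hv : ∀ i, 0 ≤ v i)
    (hv0 : v ≠ 0) (h : A *ᵥ v = r • v) (i : n) : 0 < v i := by
  classical
  obtain ⟨j, hj⟩ : ∃ j, v j ≠ 0 := Function.ne_iff.1 hv0
  obtain ⟨k, -, hk⟩ := exists_pow_apply_pos hA i j
  have hpos : 0 < r ^ k * v i := by
    simpa only [pow_mulVec_eq h, Pi.smul_apply, smul_eq_mul] using
      mulVec_apply_pos (pow_apply_nonneg hA.nonneg k) hv hk ((hv j).lt_of_ne' hj)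
  exact (hv i).lt_of_ne' (right_ne_zero_of_mul hpos.ne')

lemma nonempty_collatzWielandtSet [Nonempty n] (hA : ∀ i j, 0 ≤ A i j) :
    (collatzWielandtSet A).Nonempty := by
  classical
  have hs := single_mem_stdSimplex ℝ (Classical.arbitrary n)
  refine ⟨(0, _), le_rfl, hs, fun i => ?_⟩
  simp only [zero_mul]
  exact Finset.sum_nonneg fun j _ => mul_nonneg (hA i j) (hs.1 j)

lemma exists_pos_mulVec_eq [Nonempty n] (hA : A.IsIrreducible) :
    ∃ (r : ℝ) (v : n → ℝ), 0 < r ∧ (∀ i, 0 < v i) ∧ A *ᵥ v = r • v := by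
  obtain ⟨⟨r, v⟩, ⟨hr, hv, hrv⟩, hmax⟩ := (isCompact_collatzWielandtSet hA.nonneg).exists_isMaxOn
    (nonempty_collatzWielandtSet hA.nonneg) continuous_fst.continuousOn
  have hv0 : v ≠ 0 := by
    rintro rfl
    simpa using hv.2
  have heq : A *ᵥ v = r • v := by
    -- Otherwise a positive matrix commuting with `A` makes `r v ≤ A v` strict in every coordinate.
    by_contra hne
    obtain ⟨B, hB, hAB⟩ := exists_pos_commute hA
    obtain ⟨j, hj⟩ := Function.ne_iff.1 (sub_ne_zero.2 hne)
    obtain ⟨l, hl⟩ := Function.ne_iff.1 hv0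
    have hz : ∀ i, 0 ≤ (A *ᵥ v - r • v) i := fun i => sub_nonneg.2 (hrv i)
    have hBv : ∀ i, 0 < (B *ᵥ v) i := fun i =>
      mulVec_apply_pos (fun i j => (hB i j).le) hv.1 (hB i l) ((hv.1 l).lt_of_ne' hl)
    have hlt : ∀ i, r * (B *ᵥ v) i < (A *ᵥ (B *ᵥ v)) i := fun i => by
      have h := mulVec_apply_pos (fun i j => (hB i j).le) hz (hB i j) ((hz j).lt_of_ne' hj)
      rw [mulVec_sub, mulVec_smul, mulVec_mulVec, ← hAB.eq, ← mulVec_mulVec] at h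
      exact sub_pos.1 h
    obtain ⟨p, hp, hrp⟩ := exists_mem_collatzWielandtSet_of_lt hr hBv hlt
    exact (hmax hp).not_gt hrp
  have hvpos := pos_of_mulVec_eq hA hv.1 hv0 heq
  classical
  refine ⟨r, v, hr.lt_of_ne' ?_, hvpos, heq⟩
  rintro rfl
  obtain ⟨k, hk, hk'⟩ := exists_pow_apply_pos hA (Classical.arbitrary n) (Classical.arbitrary n)
  have hpos := mulVec_apply_pos (pow_apply_nonneg hA.nonneg k) hv.1 hk' (hvpos _)
  simp [pow_mulVec_eq heq, hk.ne'] at hpos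

variable [DecidableEq n]

lemma norm_le_of_mem_spectrum (hA : ∀ i j, 0 ≤ A i j) {v : n → ℝ} {r : ℝ} (hv : ∀ i, 0 < v i)
    (h : ∀ i, (A *ᵥ v) i ≤ r * v i) {μ : ℂ} (hμ : μ ∈ spectrum ℂ (A.map (algebraMap ℝ ℂ))) :
    ‖μ‖ ≤ r := by
  rw [← spectrum_toLin', ← Module.End.hasEigenvalue_iff_mem_spectrum] at hμ
  obtain ⟨z, hz⟩ := hμ.exists_hasEigenvector
  obtain ⟨l, hl⟩ := Function.ne_iff.1 hz.2
  have : Nonempty n := ⟨l⟩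
  obtain ⟨i, hi⟩ := Finite.exists_max fun i => ‖z i‖ / v i
  have hzi : 0 < ‖z i‖ := by
    have := (div_pos (norm_pos_iff.2 hl) (hv l)).trans_le (hi l)
    exact (div_pos_iff_of_pos_right (hv i)).1 this
  refine le_of_mul_le_mul_right ?_ hzi
  calc ‖μ‖ * ‖z i‖ = ‖(toLin' (A.map (algebraMap ℝ ℂ)) z) i‖ := by
        rw [hz.apply_eq_smul, Pi.smul_apply, smul_eq_mul, norm_mul]
    _ ≤ ∑ j, A i j * ‖z j‖ := by
        refine (norm_sum_le _ _).trans_eq (Finset.sum_congr rfl fun j _ => ?_)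
        simp [abs_of_nonneg (hA i j)]
    _ ≤ ∑ j, A i j * (‖z i‖ / v i * v j) := Finset.sum_le_sum fun j _ =>
        mul_le_mul_of_nonneg_left ((div_le_iff₀ (hv j)).1 (hi j)) (hA i j)
    _ = ‖z i‖ / v i * (A *ᵥ v) i := by
        simp only [mulVec, dotProduct, Finset.mul_sum]
        exact Finset.sum_congr rfl fun j _ => by ring
    _ ≤ ‖z i‖ / v i * (r * v i) :=
        mul_le_mul_of_nonneg_left (h i) (div_nonneg (norm_nonneg _) (hv i).le)
    _ = r * ‖z i‖ := by field_simp [(hv i).ne']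

lemma ofReal_mem_spectrum [Nonempty n] {v : n → ℝ} {r : ℝ} (hv : ∀ i, 0 < v i)
    (h : A *ᵥ v = r • v) : (r : ℂ) ∈ spectrum ℂ (A.map (algebraMap ℝ ℂ)) := by
  rw [← spectrum_toLin', ← Module.End.hasEigenvalue_iff_mem_spectrum]
  refine Module.End.hasEigenvalue_of_hasEigenvector (x := fun i => (v i : ℂ))
    (Module.End.hasEigenvector_iff.2 ⟨Module.End.mem_eigenspace_iff.2 (funext fun i => ?_), ?_⟩)
  · have hi := congrFun h i
    simp only [mulVec, dotProduct, Pi.smul_apply, smul_eq_mul] at hi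
    simp only [toLin'_apply, mulVec, dotProduct, map_apply, Pi.smul_apply, smul_eq_mul,
      Complex.coe_algebraMap]
    exact_mod_cast hi
  · exact Function.ne_iff.2 ⟨Classical.arbitrary n, Complex.ofReal_ne_zero.2 (hv _).ne'⟩

lemma spectralRadius_le_ofReal (hA : ∀ i j, 0 ≤ A i j) {v : n → ℝ} {r : ℝ}
    (hv : ∀ i, 0 < v i) (h : ∀ i, (A *ᵥ v) i ≤ r * v i) :
    spectralRadius ℂ (A.map (algebraMap ℝ ℂ)) ≤ ENNReal.ofReal r :=
  iSup₂_le fun μ hμ => by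
    rw [← enorm_eq_nnnorm, ← ofReal_norm]
    exact ENNReal.ofReal_le_ofReal (norm_le_of_mem_spectrum hA hv h hμ)

lemma pfEigenvalue_transpose (A : Matrix n n ℝ) : pfEigenvalue Aᵀ = pfEigenvalue A := by
  have hspec (B : Matrix n n ℂ) : spectrum ℂ Bᵀ = spectrum ℂ B := by
    ext μ
    rw [spectrum.mem_iff, spectrum.mem_iff, ← isUnit_transpose (A := algebraMap ℂ _ μ - B),
      transpose_sub, algebraMap_eq_diagonal, diagonal_transpose]
  rw [pfEigenvalue, pfEigenvalue, spectralRadius, spectralRadius, transpose_map, hspec]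

variable [Nonempty n]

lemma pfEigenvalue_le (hA : ∀ i j, 0 ≤ A i j) {v : n → ℝ} {r : ℝ} (hv : ∀ i, 0 < v i)
    (h : ∀ i, (A *ᵥ v) i ≤ r * v i) : pfEigenvalue A ≤ r := by
  have hAv : 0 ≤ (A *ᵥ v) (Classical.arbitrary n) :=
    Finset.sum_nonneg fun j _ => mul_nonneg (hA _ j) (hv j).le
  exact ENNReal.toReal_le_of_le_ofReal (nonneg_of_mul_nonneg_left (hAv.trans (h _)) (hv _))
    (spectralRadius_le_ofReal hA hv h)

lemma pfEigenvalue_eq_of_mulVec_eq (hA : ∀ i j, 0 ≤ A i j) {v : n → ℝ} {r : ℝ}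
    (hv : ∀ i, 0 < v i) (h : A *ᵥ v = r • v) : pfEigenvalue A = r := by
  have hle : ∀ i, (A *ᵥ v) i ≤ r * v i := fun i => (congrFun h i).le
  refine (pfEigenvalue_le hA hv hle).antisymm ?_
  have hr := le_iSup₂ (f := fun (μ : ℂ) (_ : μ ∈ spectrum ℂ (A.map (algebraMap ℝ ℂ))) => ‖μ‖ₑ) _
    (ofReal_mem_spectrum hv h)
  have hfin := (spectralRadius_le_ofReal hA hv hle).trans_lt ENNReal.ofReal_lt_top
  calc r ≤ ‖(r : ℂ)‖ := by
        rw [Complex.norm_real]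
        exact le_abs_self r
    _ ≤ pfEigenvalue A := by
        simpa only [toReal_enorm, pfEigenvalue] using ENNReal.toReal_mono hfin.ne hr

lemma exists_pos_mulVec_eq_pfEigenvalue (hA : A.IsIrreducible) :
    ∃ v : n → ℝ, (∀ i, 0 < v i) ∧ A *ᵥ v = pfEigenvalue A • v := by
  obtain ⟨r, v, -, hv, h⟩ := exists_pos_mulVec_eq hA
  exact ⟨v, hv, by rw [pfEigenvalue_eq_of_mulVec_eq hA.nonneg hv h, h]⟩

lemma exists_pos_vecMul_eq_pfEigenvalue (hA : A.IsIrreducible) :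
    ∃ u : n → ℝ, (∀ i, 0 < u i) ∧ u ᵥ* A = pfEigenvalue A • u := by
  obtain ⟨u, hu, h⟩ := exists_pos_mulVec_eq_pfEigenvalue hA.transpose
  exact ⟨u, hu, by rw [← mulVec_transpose, h, pfEigenvalue_transpose]⟩

lemma pfEigenvalue_pos (hA : A.IsIrreducible) : 0 < pfEigenvalue A := by
  obtain ⟨r, v, hr, hv, h⟩ := exists_pos_mulVec_eq hA
  rwa [pfEigenvalue_eq_of_mulVec_eq hA.nonneg hv h]

lemma le_pfEigenvalue (hA : A.IsIrreducible) {w : n → ℝ} {r : ℝ} (hw : ∀ i, 0 < w i)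
    (h : ∀ i, r * w i ≤ (A *ᵥ w) i) : r ≤ pfEigenvalue A := by
  obtain ⟨u, hu, hAu⟩ := exists_pos_vecMul_eq_pfEigenvalue hA
  refine le_of_mul_le_mul_right ?_ (dotProduct_pos hu hw)
  calc r * (u ⬝ᵥ w) = ∑ i, u i * (r * w i) := by
        simp only [dotProduct, Finset.mul_sum, mul_left_comm]
    _ ≤ u ⬝ᵥ (A *ᵥ w) := Finset.sum_le_sum fun i _ => mul_le_mul_of_nonneg_left (h i) (hu i).le
    _ = pfEigenvalue A * (u ⬝ᵥ w) := by rw [dotProduct_mulVec, hAu, smul_dotProduct, smul_eq_mul]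

lemma mulVec_eq_of_mulVec_le_pfEigenvalue (hA : A.IsIrreducible) {w : n → ℝ}
    (h : ∀ i, (A *ᵥ w) i ≤ pfEigenvalue A * w i) (i : n) :
    (A *ᵥ w) i = pfEigenvalue A * w i := by
  obtain ⟨u, hu, hAu⟩ := exists_pos_vecMul_eq_pfEigenvalue hA
  have hsum : ∑ i, u i * (A *ᵥ w) i = ∑ i, u i * (pfEigenvalue A * w i) :=
    calc u ⬝ᵥ (A *ᵥ w) = pfEigenvalue A * (u ⬝ᵥ w) := by
          rw [dotProduct_mulVec, hAu, smul_dotProduct, smul_eq_mul]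
      _ = ∑ i, u i * (pfEigenvalue A * w i) := by
          simp only [dotProduct, Finset.mul_sum, mul_left_comm]
  have heq := (Finset.sum_eq_sum_iff_of_le fun i _ =>
    mul_le_mul_of_nonneg_left (h i) (hu i).le).1 hsum i (Finset.mem_univ i)
  exact mul_left_cancel₀ (hu i).ne' heq

lemma pfEigenvalue_of_mem_rowStochastic (hA : A ∈ rowStochastic ℝ n) : pfEigenvalue A = 1 :=
  pfEigenvalue_eq_of_mulVec_eq hA.1 (v := 1) (fun _ => one_pos) (by rw [hA.2, one_smul])

lemma pfEigenvalue_of_mem_colStochastic (hA : A ∈ colStochastic ℝ n) : pfEigenvalue A = 1 := by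
  rw [← pfEigenvalue_transpose,
    pfEigenvalue_of_mem_rowStochastic (transpose_mem_rowStochastic_iff_mem_colStochastic.2 hA)]

lemma pfEigenvalue_eq_of_sum_fiber [Fintype m] [DecidableEq m] [Nonempty m]
    {B : Matrix m m ℝ} {π : n → m} (hA : ∀ i j, 0 ≤ A i j) (hB : B.IsIrreducible)
    (h : ∀ k j, ∑ i with π i = k, A i j = B k (π j)) : pfEigenvalue A = pfEigenvalue B := by
  obtain ⟨u, hu, hBu⟩ := exists_pos_vecMul_eq_pfEigenvalue hB
  rw [← pfEigenvalue_transpose]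
  refine pfEigenvalue_eq_of_mulVec_eq (v := u ∘ π) (fun i j => hA j i) (fun i => hu _)
    (funext fun j => ?_)
  calc (Aᵀ *ᵥ (u ∘ π)) j = ∑ k, ∑ i with π i = k, u (π i) * A i j := by
        rw [Finset.sum_fiberwise, mulVec_transpose]
        rfl
    _ = ∑ k, u k * B k (π j) := Finset.sum_congr rfl fun k _ => by
        rw [← h, Finset.mul_sum]
        exact Finset.sum_congr rfl fun i hi => by rw [(Finset.mem_filter.1 hi).2]
    _ = pfEigenvalue B * u (π j) := congrFun hBu (π j)

end PerronFrobenius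

section DiagonalConjugation

open Matrix

variable {n : Type*} {A : Matrix n n ℝ}

/-- The matrix `e ^ c • (D * A * D⁻¹)` with `D = diag (e ^ g)`. -/
noncomputable def diagConj (c : ℝ) (g : n → ℝ) (A : Matrix n n ℝ) : Matrix n n ℝ :=
  of fun i j => Real.exp (c + g i - g j) * A i j

lemma diagConj_apply (c : ℝ) (g : n → ℝ) (A : Matrix n n ℝ) (i j : n) :
    diagConj c g A i j = Real.exp (c + g i - g j) * A i j := rfl

lemma diagConj_diagConj (c d : ℝ) (g h : n → ℝ) (A : Matrix n n ℝ) :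
    diagConj c g (diagConj d h A) = diagConj (c + d) (g + h) A := by
  ext i j
  simp only [diagConj_apply, Pi.add_apply, ← mul_assoc, ← Real.exp_add]
  ring_nf

lemma diagConj_zero (A : Matrix n n ℝ) : diagConj 0 0 A = A := by
  ext i j
  simp [diagConj_apply]

lemma isIrreducible_diagConj (hA : A.IsIrreducible) (c : ℝ) (g : n → ℝ) :
    (diagConj c g A).IsIrreducible :=
  isIrreducible_of_pos hA (fun i j => mul_nonneg (Real.exp_pos _).le (hA.nonneg i j))
    fun _ _ h => mul_pos (Real.exp_pos _) h

variable [Fintype n] [DecidableEq n] [Nonempty n]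

lemma pfEigenvalue_diagConj (hA : A.IsIrreducible) (c : ℝ) (g : n → ℝ) :
    pfEigenvalue (diagConj c g A) = Real.exp c * pfEigenvalue A := by
  obtain ⟨v, hv, hAv⟩ := exists_pos_mulVec_eq_pfEigenvalue hA
  refine pfEigenvalue_eq_of_mulVec_eq (isIrreducible_diagConj hA c g).nonneg
    (v := fun i => Real.exp (g i) * v i) (fun i => mul_pos (Real.exp_pos _) (hv i))
    (funext fun i => ?_)
  calc ∑ j, diagConj c g A i j * (Real.exp (g j) * v j)
      = ∑ j, Real.exp (c + g i) * (A i j * v j) := Finset.sum_congr rfl fun j _ => by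
        rw [diagConj_apply, Real.exp_sub]
        field_simp
    _ = Real.exp (c + g i) * (pfEigenvalue A * v i) := by
        rw [← Finset.mul_sum]
        exact congrArg _ (congrFun hAv i)
    _ = Real.exp c * pfEigenvalue A * (Real.exp (g i) * v i) := by
        rw [Real.exp_add]
        ring

lemma log_pfEigenvalue_diagConj (hA : A.IsIrreducible) (c : ℝ) (g : n → ℝ) :
    Real.log (pfEigenvalue (diagConj c g A)) = c + Real.log (pfEigenvalue A) := by
  rw [pfEigenvalue_diagConj hA, Real.log_mul (Real.exp_pos c).ne' (pfEigenvalue_pos hA).ne',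
    Real.log_exp]

lemma exists_rowStochastic_diagConj (hA : A.IsIrreducible) :
    ∃ (g : n → ℝ) (P : Matrix n n ℝ), P ∈ rowStochastic ℝ n ∧ P.IsIrreducible ∧
      A = diagConj (Real.log (pfEigenvalue A)) g P := by
  obtain ⟨v, hv, hAv⟩ := exists_pos_mulVec_eq_pfEigenvalue hA
  have hr := pfEigenvalue_pos hA
  have hP := isIrreducible_diagConj hA (-Real.log (pfEigenvalue A)) fun i => -Real.log (v i)
  refine ⟨fun i => Real.log (v i), _, ?_, hP, ?_⟩
  · refine mem_rowStochastic_iff_sum.2 ⟨hP.nonneg, fun i => ?_⟩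
    calc ∑ j, diagConj (-Real.log (pfEigenvalue A)) (fun i => -Real.log (v i)) A i j
        = ∑ j, (pfEigenvalue A)⁻¹ * (v i)⁻¹ * (A i j * v j) := Finset.sum_congr rfl fun j _ => by
          rw [diagConj_apply, sub_neg_eq_add, Real.exp_add, Real.exp_add, Real.exp_neg,
            Real.exp_neg, Real.exp_log hr, Real.exp_log (hv i), Real.exp_log (hv j)]
          ring
      _ = (pfEigenvalue A)⁻¹ * (v i)⁻¹ * (pfEigenvalue A * v i) := by
          rw [← Finset.mul_sum]
          exact congrArg _ (congrFun hAv i)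
      _ = 1 := by field_simp [hr.ne', (hv i).ne']
  · rw [diagConj_diagConj, add_neg_cancel]
    convert (diagConj_zero A).symm using 2
    exact funext fun i => add_neg_cancel _

end DiagonalConjugation

section LogConvexity

section Holder

variable {ι : Type*} {s : Finset ι} {p q : ι → ℝ} {a b : ℝ}

lemma sum_rpow_mul_rpow_le_add (ha : 0 < a) (hb : 0 < b) (hab : a + b = 1)
    (hp : ∀ i ∈ s, 0 ≤ p i) (hq : ∀ i ∈ s, 0 ≤ q i) :
    ∑ i ∈ s, p i ^ a * q i ^ b ≤ a * ∑ i ∈ s, p i + b * ∑ i ∈ s, q i := by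
  rw [Finset.mul_sum, Finset.mul_sum, ← Finset.sum_add_distrib]
  exact Finset.sum_le_sum fun i hi =>
    Real.geom_mean_le_arith_mean2_weighted ha.le hb.le (hp i hi) (hq i hi) hab

lemma eq_of_sum_rpow_mul_rpow_eq_add (ha : 0 < a) (hb : 0 < b) (hab : a + b = 1)
    (hp : ∀ i ∈ s, 0 ≤ p i) (hq : ∀ i ∈ s, 0 ≤ q i)
    (h : ∑ i ∈ s, p i ^ a * q i ^ b = a * ∑ i ∈ s, p i + b * ∑ i ∈ s, q i) {i : ι} (hi : i ∈ s) :
    p i = q i := by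
  rw [Finset.mul_sum, Finset.mul_sum, ← Finset.sum_add_distrib] at h
  have amgm_eq := (Finset.sum_eq_sum_iff_of_le fun i hi =>
    Real.geom_mean_le_arith_mean2_weighted ha.le hb.le (hp i hi) (hq i hi) hab).1 h i hi
  exact (Real.geom_mean_eq_arith_mean2_weighted_iff_of_pos ha hb (hp i hi) (hq i hi) hab).1 amgm_eq

lemma sum_div_rpow_mul_div_rpow {P Q : ℝ} (hP : 0 < P) (hQ : 0 < Q)
    (hp : ∀ i ∈ s, 0 ≤ p i) (hq : ∀ i ∈ s, 0 ≤ q i) :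
    ∑ i ∈ s, (p i / P) ^ a * (q i / Q) ^ b = (∑ i ∈ s, p i ^ a * q i ^ b) / (P ^ a * Q ^ b) := by
  rw [Finset.sum_div]
  refine Finset.sum_congr rfl fun i hi => ?_
  rw [Real.div_rpow (hp i hi) hP.le, Real.div_rpow (hq i hi) hQ.le, div_mul_div_comm]

lemma sum_rpow_mul_rpow_le (ha : 0 < a) (hb : 0 < b) (hab : a + b = 1)
    (hp : ∀ i ∈ s, 0 ≤ p i) (hq : ∀ i ∈ s, 0 ≤ q i)
    (hP : 0 < ∑ i ∈ s, p i) (hQ : 0 < ∑ i ∈ s, q i) :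
    ∑ i ∈ s, p i ^ a * q i ^ b ≤ (∑ i ∈ s, p i) ^ a * (∑ i ∈ s, q i) ^ b := by
  have normalized := sum_rpow_mul_rpow_le_add ha hb hab
    (fun i hi => div_nonneg (hp i hi) hP.le) (fun i hi => div_nonneg (hq i hi) hQ.le)
  rwa [sum_div_rpow_mul_div_rpow hP hQ hp hq, ← Finset.sum_div, ← Finset.sum_div,
    div_self hP.ne', div_self hQ.ne', mul_one, mul_one, hab,
    div_le_one (by positivity)] at normalized

lemma div_sum_eq_of_sum_rpow_mul_rpow_eq (ha : 0 < a) (hb : 0 < b) (hab : a + b = 1)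
    (hp : ∀ i ∈ s, 0 ≤ p i) (hq : ∀ i ∈ s, 0 ≤ q i)
    (hP : 0 < ∑ i ∈ s, p i) (hQ : 0 < ∑ i ∈ s, q i)
    (h : ∑ i ∈ s, p i ^ a * q i ^ b = (∑ i ∈ s, p i) ^ a * (∑ i ∈ s, q i) ^ b)
    {i : ι} (hi : i ∈ s) : p i / ∑ j ∈ s, p j = q i / ∑ j ∈ s, q j := by
  refine eq_of_sum_rpow_mul_rpow_eq_add (p := fun i => p i / ∑ j ∈ s, p j)
    (q := fun i => q i / ∑ j ∈ s, q j) ha hb hab (fun i hi => div_nonneg (hp i hi) hP.le)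
    (fun i hi => div_nonneg (hq i hi) hQ.le) ?_ hi
  rw [sum_div_rpow_mul_div_rpow hP hQ hp hq, ← Finset.sum_div, ← Finset.sum_div,
    div_self hP.ne', div_self hQ.ne', mul_one, mul_one, hab, h, div_self (by positivity)]

end Holder

open Matrix

variable {n : Type*} {A B C P Q : Matrix n n ℝ} {a b : ℝ}

lemma diagConj_rpow_mul_rpow (hP : ∀ i j, 0 ≤ P i j) (hQ : ∀ i j, 0 ≤ Q i j) (c d : ℝ)
    (g h : n → ℝ) (i j : n) :
    diagConj c g P i j ^ a * diagConj d h Q i j ^ b =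
      Real.exp ((a * c + b * d) + (a • g + b • h) i - (a • g + b • h) j) *
        (P i j ^ a * Q i j ^ b) := by
  simp only [diagConj_apply]
  rw [Real.mul_rpow (Real.exp_nonneg _) (hP i j), Real.mul_rpow (Real.exp_nonneg _) (hQ i j),
    ← Real.exp_mul, ← Real.exp_mul, mul_mul_mul_comm, ← Real.exp_add]
  simp only [Pi.add_apply, Pi.smul_apply, smul_eq_mul]
  ring_nf

variable [Fintype n] [DecidableEq n] [Nonempty n]

lemma pfEigenvalue_le_one_of_le_rpow_mul_rpow (ha : 0 < a) (hb : 0 < b) (hab : a + b = 1)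
    (hP : P ∈ rowStochastic ℝ n) (hQ : Q ∈ rowStochastic ℝ n) (hC : ∀ i j, 0 ≤ C i j)
    (h : ∀ i j, C i j ≤ P i j ^ a * Q i j ^ b) : pfEigenvalue C ≤ 1 := by
  refine pfEigenvalue_le (v := 1) hC (fun _ => one_pos) fun i => ?_
  calc (C *ᵥ 1) i = ∑ j, C i j := by simp only [mulVec, dotProduct, Pi.one_apply, mul_one]
    _ ≤ ∑ j, P i j ^ a * Q i j ^ b := Finset.sum_le_sum fun j _ => h i j
    _ ≤ a * ∑ j, P i j + b * ∑ j, Q i j :=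
        sum_rpow_mul_rpow_le_add ha hb hab (fun j _ => hP.1 i j) fun j _ => hQ.1 i j
    _ = 1 * (1 : n → ℝ) i := by
        rw [sum_row_of_mem_rowStochastic hP, sum_row_of_mem_rowStochastic hQ, mul_one, mul_one,
          hab, Pi.one_apply, one_mul]

lemma eq_of_le_rpow_mul_rpow_of_pfEigenvalue_eq_one (ha : 0 < a) (hb : 0 < b) (hab : a + b = 1)
    (hP : P ∈ rowStochastic ℝ n) (hQ : Q ∈ rowStochastic ℝ n) (hC : C.IsIrreducible)
    (h : ∀ i j, C i j ≤ P i j ^ a * Q i j ^ b) (hρ : pfEigenvalue C = 1) : C = P ∧ P = Q := by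
  have sum_le (i) : ∑ j, P i j ^ a * Q i j ^ b ≤ 1 := by
    refine (sum_rpow_mul_rpow_le_add ha hb hab (fun j _ => hP.1 i j)
      fun j _ => hQ.1 i j).trans_eq ?_
    rw [sum_row_of_mem_rowStochastic hP, sum_row_of_mem_rowStochastic hQ, mul_one, mul_one, hab]
  have sum_C (i) : ∑ j, C i j = 1 := by
    have := mulVec_eq_of_mulVec_le_pfEigenvalue (w := 1) hC (fun i => ?_) i
    · simpa only [mulVec, dotProduct, hρ, Pi.one_apply, mul_one] using this
    · simpa only [mulVec, dotProduct, hρ, Pi.one_apply, mul_one] using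
        (Finset.sum_le_sum fun j _ => h i j).trans (sum_le i)
  have sum_eq (i) : ∑ j, P i j ^ a * Q i j ^ b = 1 :=
    (sum_le i).antisymm ((sum_C i).symm.trans_le (Finset.sum_le_sum fun j _ => h i j))
  have P_eq_Q (i j) : P i j = Q i j := by
    refine eq_of_sum_rpow_mul_rpow_eq_add ha hb hab (fun j _ => hP.1 i j) (fun j _ => hQ.1 i j) ?_
      (Finset.mem_univ j)
    rw [sum_eq, sum_row_of_mem_rowStochastic hP, sum_row_of_mem_rowStochastic hQ, mul_one,
      mul_one, hab]
  refine ⟨Matrix.ext fun i j => ?_, Matrix.ext P_eq_Q⟩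
  have C_eq := (Finset.sum_eq_sum_iff_of_le fun j _ => h i j).1 ((sum_C i).trans (sum_eq i).symm) j
    (Finset.mem_univ j)
  rw [C_eq, ← P_eq_Q, ← Real.rpow_add_of_nonneg (hP.1 i j) ha.le hb.le, hab, Real.rpow_one]

lemma exists_rowStochastic_diagConj_le (hA : A.IsIrreducible) (hB : B.IsIrreducible)
    (h : ∀ i j, C i j ≤ A i j ^ a * B i j ^ b) :
    ∃ (gA gB g : n → ℝ) (P Q : Matrix n n ℝ), P ∈ rowStochastic ℝ n ∧ Q ∈ rowStochastic ℝ n ∧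
      A = diagConj (Real.log (pfEigenvalue A)) gA P ∧
      B = diagConj (Real.log (pfEigenvalue B)) gB Q ∧
      g = a • gA + b • gB ∧
      ∀ i j, diagConj (-(a * Real.log (pfEigenvalue A) + b * Real.log (pfEigenvalue B))) (-g) C i j
        ≤ P i j ^ a * Q i j ^ b := by
  obtain ⟨gA, P, hP, -, hAP⟩ := exists_rowStochastic_diagConj hA
  obtain ⟨gB, Q, hQ, -, hBQ⟩ := exists_rowStochastic_diagConj hB
  refine ⟨gA, gB, _, P, Q, hP, hQ, hAP, hBQ, rfl, fun i j => ?_⟩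
  have := h i j
  rw [hAP, hBQ, diagConj_rpow_mul_rpow hP.1 hQ.1] at this
  rw [diagConj_apply]
  refine (mul_le_mul_of_nonneg_left this (Real.exp_nonneg _)).trans_eq ?_
  rw [← mul_assoc, ← Real.exp_add]
  simp only [Pi.neg_apply]
  ring_nf
  rw [Real.exp_zero, one_mul]

theorem log_pfEigenvalue_le_add (hA : A.IsIrreducible) (hB : B.IsIrreducible)
    (hC : C.IsIrreducible) (ha : 0 < a) (hb : 0 < b) (hab : a + b = 1)
    (h : ∀ i j, C i j ≤ A i j ^ a * B i j ^ b) :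
    Real.log (pfEigenvalue C) ≤ a * Real.log (pfEigenvalue A) + b * Real.log (pfEigenvalue B) := by
  obtain ⟨gA, gB, g, P, Q, hP, hQ, -, -, -, hle⟩ := exists_rowStochastic_diagConj_le hA hB h
  have hC' := isIrreducible_diagConj hC
    (-(a * Real.log (pfEigenvalue A) + b * Real.log (pfEigenvalue B))) (-g)
  have := Real.log_nonpos (pfEigenvalue_pos hC').le
    (pfEigenvalue_le_one_of_le_rpow_mul_rpow ha hb hab hP hQ hC'.nonneg hle)
  rw [log_pfEigenvalue_diagConj hC] at this
  linarith

theorem exists_eq_diagConj_of_log_pfEigenvalue_eq_add (hA : A.IsIrreducible) (hB : B.IsIrreducible)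
    (hC : C.IsIrreducible) (ha : 0 < a) (hb : 0 < b) (hab : a + b = 1)
    (h : ∀ i j, C i j ≤ A i j ^ a * B i j ^ b)
    (heq : Real.log (pfEigenvalue C) =
      a * Real.log (pfEigenvalue A) + b * Real.log (pfEigenvalue B)) :
    (∀ i j, C i j = A i j ^ a * B i j ^ b) ∧ ∃ c g, A = diagConj c g B := by
  obtain ⟨gA, gB, g, P, Q, hP, hQ, hAP, hBQ, rfl, hle⟩ := exists_rowStochastic_diagConj_le hA hB h
  have hC' := isIrreducible_diagConj hC
    (-(a * Real.log (pfEigenvalue A) + b * Real.log (pfEigenvalue B))) (-(a • gA + b • gB))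
  have hρ : pfEigenvalue (diagConj (-(a * Real.log (pfEigenvalue A) +
      b * Real.log (pfEigenvalue B))) (-(a • gA + b • gB)) C) = 1 :=
    Real.eq_one_of_pos_of_log_eq_zero (pfEigenvalue_pos hC') (by
      rw [log_pfEigenvalue_diagConj hC, heq, neg_add_cancel])
  obtain ⟨hCP, rfl⟩ := eq_of_le_rpow_mul_rpow_of_pfEigenvalue_eq_one ha hb hab hP hQ hC' hle hρ
  set α := Real.log (pfEigenvalue A)
  set β := Real.log (pfEigenvalue B)
  refine ⟨fun i j => ?_, α - β, gA - gB, ?_⟩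
  · have C_eq : C = diagConj (a * α + b * β) (a • gA + b • gB) P := by
      rw [← hCP, diagConj_diagConj, add_neg_cancel, add_neg_cancel, diagConj_zero]
    rw [C_eq, hAP, hBQ, diagConj_rpow_mul_rpow hP.1 hP.1,
      ← Real.rpow_add_of_nonneg (hP.1 i j) ha.le hb.le, hab, Real.rpow_one, diagConj_apply]
  · rw [hAP, hBQ, diagConj_diagConj, sub_add_cancel, sub_add_cancel]

end LogConvexity

section Perturbation

open Matrix Asymptotics

variable {n : Type*} [Fintype n]

-- The vector `h` is the first-order correction to the eigenvector `v`.
lemma mulVec_sub_isLittleO_of_hasDerivAt {A : ℝ → Matrix n n ℝ} {A' : Matrix n n ℝ} {t₀ r m : ℝ}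
    {v h : n → ℝ} (hA' : ∀ i j, HasDerivAt (fun t => A t i j) (A' i j) t₀)
    (hAv : A t₀ *ᵥ v = r • v) (hh : A t₀ *ᵥ h - r • h = m • v - A' *ᵥ v) (i : n) :
    (fun t => (A t *ᵥ fun j => v j + (t - t₀) * h j) i -
      (r + (t - t₀) * m) * (v i + (t - t₀) * h i)) =o[𝓝 t₀] fun t => t - t₀ := by
  have hline (x y : ℝ) : HasDerivAt (fun t => x + (t - t₀) * y) y t₀ := by
    simpa using (((hasDerivAt_id t₀).sub_const t₀).mul_const y).const_add x
  have herr : HasDerivAt (fun t => (A t *ᵥ fun j => v j + (t - t₀) * h j) i -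
      (r + (t - t₀) * m) * (v i + (t - t₀) * h i))
      (∑ j, (A' i j * v j + A t₀ i j * h j) - (m * v i + r * h i)) t₀ := by
    simp only [mulVec, dotProduct]
    refine HasDerivAt.sub (HasDerivAt.fun_sum fun j _ => ?_) ?_
    · simpa using (hA' i j).fun_mul (hline (v j) (h j))
    · simpa using (hline r m).fun_mul (hline (v i) (h i))
  have hderiv : ∑ j, (A' i j * v j + A t₀ i j * h j) - (m * v i + r * h i) = 0 := by
    have := congrFun hh i
    simp only [mulVec, dotProduct, Pi.sub_apply, Pi.smul_apply, smul_eq_mul] at this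
    rw [Finset.sum_add_distrib]
    linarith
  have hvalue : (A t₀ *ᵥ fun j => v j + (t₀ - t₀) * h j) i = r * v i := by
    simpa using congrFun hAv i
  rw [hderiv, hasDerivAt_iff_isLittleO] at herr
  exact herr.congr_left fun t => by rw [hvalue, smul_zero]; ring

variable [Nonempty n]

lemma exists_smul_eq_of_mulVec_eq {A : Matrix n n ℝ} (hA : A.IsIrreducible) {v x : n → ℝ} {r : ℝ}
    (hv : ∀ i, 0 < v i) (hAv : A *ᵥ v = r • v) (hAx : A *ᵥ x = r • x) : ∃ c : ℝ, c • v = x := by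
  obtain ⟨i₀, hi₀⟩ := Finite.exists_min fun i => x i / v i
  set c := x i₀ / v i₀
  -- `x - c • v` is a nonnegative eigenvector with a zero, so it vanishes.
  refine ⟨c, by_contra fun hne => ?_⟩
  have heigen : A *ᵥ (x - c • v) = r • (x - c • v) := by
    rw [mulVec_sub, mulVec_smul, hAv, hAx, smul_sub, smul_comm]
  have hnonneg (i) : 0 ≤ (x - c • v) i := sub_nonneg.2 ((le_div_iff₀ (hv i)).1 (hi₀ i))
  have hpos := pos_of_mulVec_eq hA hnonneg (sub_ne_zero.2 (Ne.symm hne)) heigen i₀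
  have hzero : (x - c • v) i₀ = 0 := sub_eq_zero.2 (div_mul_cancel₀ _ (hv i₀).ne').symm
  exact hpos.ne' hzero

lemma exists_mulVec_sub_smul_eq {A : Matrix n n ℝ} (hA : A.IsIrreducible) {u v z : n → ℝ} {r : ℝ}
    (hu : ∀ i, 0 < u i) (hv : ∀ i, 0 < v i) (hAu : u ᵥ* A = r • u) (hAv : A *ᵥ v = r • v)
    (hz : u ⬝ᵥ z = 0) : ∃ h : n → ℝ, A *ᵥ h - r • h = z := by
  classical
  let T : (n → ℝ) →ₗ[ℝ] (n → ℝ) := A.mulVecLin - r • LinearMap.id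
  let ℓ : Module.Dual ℝ (n → ℝ) := dotProductBilin ℝ ℝ u
  have hv0 : v ≠ 0 := fun h => (hv (Classical.arbitrary n)).ne' (congrFun h _)
  have hℓ0 : ℓ ≠ 0 := fun h => (dotProduct_pos hu hv).ne' (LinearMap.congr_fun h v)
  have hker : LinearMap.ker T = Submodule.span ℝ {v} := by
    ext x
    rw [LinearMap.mem_ker, Submodule.mem_span_singleton]
    refine ⟨fun h => exists_smul_eq_of_mulVec_eq hA hv hAv (sub_eq_zero.1 h), ?_⟩
    rintro ⟨c, rfl⟩
    exact sub_eq_zero.2 (by rw [mulVecLin_apply, mulVec_smul, hAv, smul_comm]; rfl)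
  have hrank : Module.finrank ℝ (LinearMap.range T) = Module.finrank ℝ (LinearMap.ker ℓ) := by
    have hT := T.finrank_range_add_finrank_ker
    have hℓ := Module.Dual.finrank_ker_add_one_of_ne_zero hℓ0
    rw [hker, finrank_span_singleton hv0] at hT
    omega
  have hle : LinearMap.range T ≤ LinearMap.ker ℓ := by
    rintro _ ⟨x, rfl⟩
    change u ⬝ᵥ (A *ᵥ x - r • x) = 0
    rw [dotProduct_sub, dotProduct_mulVec, hAu, smul_dotProduct, dotProduct_smul, sub_self]
  have hzmem : z ∈ LinearMap.range T := by
    rw [Submodule.eq_of_le_of_finrank_eq hle hrank]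
    exact hz
  exact hzmem

variable [DecidableEq n]

lemma pfEigenvalue_sub_isLittleO {l : Filter ℝ} {A : ℝ → Matrix n n ℝ} {w : ℝ → n → ℝ}
    {μ b : ℝ → ℝ} {δ : ℝ} (hδ : 0 < δ) (hA : ∀ᶠ t in l, (A t).IsIrreducible)
    (hw : ∀ i, ∀ᶠ t in l, δ ≤ w t i)
    (h : ∀ i, (fun t => (A t *ᵥ w t) i - μ t * w t i) =o[l] b) :
    (fun t => pfEigenvalue (A t) - μ t) =o[l] b := by
  refine isLittleO_iff.2 fun c hc => ?_
  filter_upwards [hA, eventually_all.2 hw,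
    eventually_all.2 fun i => isLittleO_iff.1 (h i) (mul_pos hc hδ)] with t hAt hwt ht
  have hpos (i) : 0 < w t i := hδ.trans_le (hwt i)
  have herr (i) : |(A t *ᵥ w t) i - μ t * w t i| ≤ c * ‖b t‖ * w t i :=
    (ht i).trans (by nlinarith [hwt i, mul_nonneg hc.le (norm_nonneg (b t))])
  have hlower : μ t - c * ‖b t‖ ≤ pfEigenvalue (A t) :=
    le_pfEigenvalue hAt hpos fun i => by linarith [(abs_le.1 (herr i)).1]
  have hupper : pfEigenvalue (A t) ≤ μ t + c * ‖b t‖ :=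
    pfEigenvalue_le hAt.nonneg hpos fun i => by linarith [(abs_le.1 (herr i)).2]
  exact abs_le.2 ⟨by linarith, by linarith⟩

lemma hasDerivAt_pfEigenvalue {A : ℝ → Matrix n n ℝ} {A' : Matrix n n ℝ} {t₀ : ℝ} {u v : n → ℝ}
    (hu : ∀ i, 0 < u i) (hv : ∀ i, 0 < v i)
    (hAu : u ᵥ* A t₀ = pfEigenvalue (A t₀) • u) (hAv : A t₀ *ᵥ v = pfEigenvalue (A t₀) • v)
    (hA : ∀ᶠ t in 𝓝 t₀, (A t).IsIrreducible)
    (hA' : ∀ i j, HasDerivAt (fun t => A t i j) (A' i j) t₀) :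
    HasDerivAt (fun t => pfEigenvalue (A t)) (u ⬝ᵥ (A' *ᵥ v) / (u ⬝ᵥ v)) t₀ := by
  set m := u ⬝ᵥ (A' *ᵥ v) / (u ⬝ᵥ v) with hm
  have horth : u ⬝ᵥ (m • v - A' *ᵥ v) = 0 := by
    rw [dotProduct_sub, dotProduct_smul, smul_eq_mul, hm,
      div_mul_cancel₀ _ (dotProduct_pos hu hv).ne', sub_self]
  obtain ⟨h, hh⟩ := exists_mulVec_sub_smul_eq hA.self_of_nhds hu hv hAu hAv horth
  obtain ⟨i₀, hi₀⟩ := Finite.exists_min v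
  refine hasDerivAt_iff_isLittleO.2 ((pfEigenvalue_sub_isLittleO (half_pos (hv i₀)) hA (fun i => ?_)
    (mulVec_sub_isLittleO_of_hasDerivAt hA' hAv hh)).congr_left fun t => by rw [smul_eq_mul]; ring)
  have hlim : Tendsto (fun t => v i + (t - t₀) * h i) (𝓝 t₀) (𝓝 (v i)) :=
    Continuous.tendsto' (by fun_prop) _ _ (by rw [sub_self, zero_mul, add_zero])
  exact (hlim.eventually_const_lt (by linarith [hi₀ i, hv i₀])).mono fun _ => le_of_lt

end Perturbation

section ExponentialTilt

open Matrix

variable {n : Type*}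

/-- The exponential tilt `A i j * e ^ (t * f i j)` of the matrix `A` in the direction `f`. -/
noncomputable def expTilt (A : Matrix n n ℝ) (f : n → n → ℝ) (t : ℝ) : Matrix n n ℝ :=
  of fun i j => A i j * Real.exp (t * f i j)

/-- On the transitions allowed by `A`, the function `f` is a constant plus a coboundary. -/
def IsConstAddCoboundary (A : Matrix n n ℝ) (f : n → n → ℝ) : Prop :=
  ∃ (c : ℝ) (g : n → ℝ), ∀ i j, 0 < A i j → f i j = c + g i - g j

variable {A P : Matrix n n ℝ} {f F : n → n → ℝ}

lemma expTilt_apply (A : Matrix n n ℝ) (f : n → n → ℝ) (t : ℝ) (i j : n) :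
    expTilt A f t i j = A i j * Real.exp (t * f i j) := rfl

lemma expTilt_zero (A : Matrix n n ℝ) (f : n → n → ℝ) : expTilt A f 0 = A := by
  ext i j
  rw [expTilt_apply, zero_mul, Real.exp_zero, mul_one]

lemma isIrreducible_expTilt (hA : A.IsIrreducible) (f : n → n → ℝ) (t : ℝ) :
    (expTilt A f t).IsIrreducible :=
  isIrreducible_of_pos hA (fun i j => mul_nonneg (hA.nonneg i j) (Real.exp_nonneg _))
    fun _ _ h => mul_pos h (Real.exp_pos _)

lemma expTilt_diagConj (c : ℝ) (g : n → ℝ) (A : Matrix n n ℝ) (f : n → n → ℝ) (t : ℝ) :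
    expTilt (diagConj c g A) f t = diagConj c g (expTilt A f t) := by
  ext i j
  simp only [expTilt_apply, diagConj_apply, mul_assoc]

lemma expTilt_eq_diagConj (hA : ∀ i j, 0 ≤ A i j) {c : ℝ} {g : n → ℝ}
    (hf : ∀ i j, 0 < A i j → f i j = c + g i - g j + F i j) (t : ℝ) :
    expTilt A f t = diagConj (t * c) (t • g) (expTilt A F t) := by
  ext i j
  rcases (hA i j).eq_or_lt with h | h
  · simp only [expTilt_apply, diagConj_apply, ← h, zero_mul, mul_zero]
  · rw [diagConj_apply, expTilt_apply, expTilt_apply, hf i j h, mul_left_comm, ← Real.exp_add]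
    simp only [Pi.smul_apply, smul_eq_mul]
    ring_nf

lemma isConstAddCoboundary_of_expTilt_eq_diagConj {s t c : ℝ} {g : n → ℝ} (hst : s ≠ t)
    (h : expTilt A f s = diagConj c g (expTilt A f t)) : IsConstAddCoboundary A f := by
  refine ⟨c / (s - t), fun i => g i / (s - t), fun i j hij => ?_⟩
  have hexp : Real.exp (s * f i j) = Real.exp (c + g i - g j + t * f i j) := by
    have := congrFun₂ h i j
    rw [diagConj_apply, expTilt_apply, expTilt_apply, mul_left_comm, ← Real.exp_add] at this
    exact mul_left_cancel₀ hij.ne' this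
  have hlin := Real.exp_injective hexp
  field_simp [sub_ne_zero.2 hst]
  linarith

lemma expTilt_add (hA : ∀ i j, 0 ≤ A i j) {a b : ℝ} (hab : a + b = 1) (ha : 0 ≤ a) (hb : 0 ≤ b)
    (s t : ℝ) (i j : n) :
    expTilt A f (a * s + b * t) i j = expTilt A f s i j ^ a * expTilt A f t i j ^ b := by
  simp only [expTilt_apply]
  rw [Real.mul_rpow (hA i j) (Real.exp_nonneg _), Real.mul_rpow (hA i j) (Real.exp_nonneg _),
    mul_mul_mul_comm, ← Real.rpow_add_of_nonneg (hA i j) ha hb, hab, Real.rpow_one,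
    ← Real.exp_mul, ← Real.exp_mul, ← Real.exp_add]
  ring_nf

variable [Fintype n] [DecidableEq n] [Nonempty n]

lemma log_pfEigenvalue_expTilt_of_eq (hA : A.IsIrreducible) {c : ℝ} {g : n → ℝ}
    (hf : ∀ i j, 0 < A i j → f i j = c + g i - g j + F i j) (t : ℝ) :
    Real.log (pfEigenvalue (expTilt A f t)) =
      t * c + Real.log (pfEigenvalue (expTilt A F t)) := by
  rw [expTilt_eq_diagConj hA.nonneg hf, log_pfEigenvalue_diagConj (isIrreducible_expTilt hA F t)]

lemma IsConstAddCoboundary.exists_log_pfEigenvalue_eq (h : IsConstAddCoboundary A f)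
    (hA : A.IsIrreducible) :
    ∃ c, ∀ t, Real.log (pfEigenvalue (expTilt A f t)) = t * c + Real.log (pfEigenvalue A) := by
  obtain ⟨c, g, hf⟩ := h
  have expTilt_zero_right (t : ℝ) : expTilt A (fun _ _ => 0) t = A := by
    ext i j
    rw [expTilt_apply, mul_zero, Real.exp_zero, mul_one]
  refine ⟨c, fun t => ?_⟩
  rw [log_pfEigenvalue_expTilt_of_eq hA (F := fun _ _ => 0) fun i j hij => by
    rw [hf i j hij, add_zero], expTilt_zero_right]

theorem convexOn_log_pfEigenvalue_expTilt (hA : A.IsIrreducible) (f : n → n → ℝ) :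
    ConvexOn ℝ univ fun t => Real.log (pfEigenvalue (expTilt A f t)) := by
  refine convexOn_iff_forall_pos.2 ⟨convex_univ, fun s _ t _ a b ha hb hab => ?_⟩
  exact log_pfEigenvalue_le_add (isIrreducible_expTilt hA f s) (isIrreducible_expTilt hA f t)
    (isIrreducible_expTilt hA f _) ha hb hab fun i j =>
      (expTilt_add hA.nonneg hab ha.le hb.le s t i j).le

theorem strictConvexOn_log_pfEigenvalue_expTilt (hA : A.IsIrreducible)
    (hf : ¬IsConstAddCoboundary A f) :
    StrictConvexOn ℝ univ fun t => Real.log (pfEigenvalue (expTilt A f t)) := by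
  refine ⟨convex_univ, fun s _ t _ hst a b ha hb hab => lt_of_le_of_ne
    ((convexOn_log_pfEigenvalue_expTilt hA f).2 trivial trivial ha.le hb.le hab) fun heq => hf ?_⟩
  obtain ⟨-, c, g, hst'⟩ := exists_eq_diagConj_of_log_pfEigenvalue_eq_add
    (isIrreducible_expTilt hA f s) (isIrreducible_expTilt hA f t) (isIrreducible_expTilt hA f _)
    ha hb hab (fun i j => (expTilt_add hA.nonneg hab ha.le hb.le s t i j).le) heq
  exact isConstAddCoboundary_of_expTilt_eq_diagConj hst hst'

end ExponentialTilt

section SecondOrder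

open Matrix Asymptotics

lemma exp_mul_one_add_sub_isLittleO (x k : ℝ) :
    (fun t : ℝ => Real.exp (t * x) * (1 + t ^ 2 * k) - (1 + t * x + t ^ 2 * (x ^ 2 / 2 + k)))
      =o[𝓝 0] fun t => t ^ 2 := by
  have hx : Tendsto (fun t : ℝ => t * x) (𝓝 0) (𝓝 0) := by
    simpa using (continuous_id.mul_const x).tendsto 0
  have hexp : (fun t : ℝ => Real.exp (t * x) - 1) =o[𝓝 0] fun _ => (1 : ℝ) :=
    (isLittleO_one_iff ℝ).2 (by simpa using ((Real.continuous_exp.tendsto 0).comp hx).sub_const 1)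
  have hmul : ((fun s : ℝ => s ^ 2) ∘ fun t : ℝ => t * x) =O[𝓝 0] fun t => t ^ 2 := by
    simpa only [Function.comp_def, mul_pow, mul_comm _ (x ^ 2)] using
      isBigO_const_mul_self (x ^ 2) (fun t : ℝ => t ^ 2) (𝓝 0)
  have htaylor : (fun t : ℝ => Real.exp (t * x) - (1 + t * x + t ^ 2 * (x ^ 2 / 2))) =o[𝓝 0]
      fun t => t ^ 2 := by
    refine (((Real.exp_sub_sum_range_succ_isLittleO_pow 2).comp_tendsto hx).trans_isBigO
      hmul).congr_left fun t => ?_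
    simp only [Function.comp_apply, Finset.sum_range_succ, Finset.sum_range_zero, Nat.factorial]
    norm_num
    ring
  have hcross : (fun t : ℝ => (Real.exp (t * x) - 1) * (k * t ^ 2)) =o[𝓝 0] fun t => t ^ 2 := by
    simpa only [one_mul] using hexp.mul_isBigO (isBigO_const_mul_self k (fun t : ℝ => t ^ 2) (𝓝 0))
  exact (htaylor.add hcross).congr_left fun t => by ring

lemma log_sub_isLittleO {φ a b : ℝ → ℝ} {l : Filter ℝ} (hb : Tendsto b l (𝓝 0)) (ha : a =O[l] b)
    (h : (fun t => φ t - (1 + a t)) =o[l] b) : (fun t => Real.log (φ t) - a t) =o[l] b := by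
  have hO : (fun t => φ t - 1) =O[l] b := (h.isBigO.add ha).congr_left fun t => by ring
  have hφ : Tendsto φ l (𝓝 1) := by simpa using (hO.trans_tendsto hb).add_const 1
  have hlog := (hasDerivAt_iff_isLittleO.1 (Real.hasDerivAt_log one_ne_zero)).comp_tendsto hφ
  refine ((hlog.trans_isBigO hO).add h).congr_left fun t => ?_
  simp only [Function.comp_apply, Real.log_one, inv_one, smul_eq_mul, mul_one]
  ring

variable {n : Type*} [Fintype n] {A P : Matrix n n ℝ}

lemma eq_zero_of_sum_mul_sq_eq_zero (hP : ∀ i j, 0 ≤ P i j) {F : n → n → ℝ}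
    (h : ∀ i, ∑ j, P i j * (F i j ^ 2 / 2) = 0) {i j : n} (hij : 0 < P i j) : F i j = 0 := by
  have hterm := (Finset.sum_eq_zero_iff_of_nonneg fun j _ =>
    mul_nonneg (hP i j) (by positivity)).1 (h i) j (Finset.mem_univ j)
  simpa [hij.ne'] using hterm

lemma dotProduct_eq_mul_of_add_mulVec_eq {u z k : n → ℝ} {m : ℝ} (hu : u ᵥ* P = u)
    (h : ∀ i, z i + (P *ᵥ k) i = m + k i) : u ⬝ᵥ z = m * (u ⬝ᵥ 1) := by
  have hz : z = m • 1 + k - P *ᵥ k := funext fun i => by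
    simp only [Pi.sub_apply, Pi.add_apply, Pi.smul_apply, Pi.one_apply, smul_eq_mul]
    linarith [h i]
  rw [hz, dotProduct_sub, dotProduct_add, dotProduct_mulVec, hu, dotProduct_smul, smul_eq_mul,
    add_sub_cancel_right]

variable [DecidableEq n] [Nonempty n]

lemma exists_add_mulVec_eq (hP : P.IsIrreducible) (hP1 : P ∈ rowStochastic ℝ n) (z : n → ℝ) :
    ∃ (m : ℝ) (k : n → ℝ), ∀ i, z i + (P *ᵥ k) i = m + k i := by
  obtain ⟨u, hu, hPu⟩ := exists_pos_vecMul_eq_pfEigenvalue hP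
  rw [pfEigenvalue_of_mem_rowStochastic hP1] at hPu
  have hone (i : n) : 0 < (1 : n → ℝ) i := one_pos
  set m := u ⬝ᵥ z / (u ⬝ᵥ 1) with hm
  obtain ⟨k, hk⟩ := exists_mulVec_sub_smul_eq hP (z := m • 1 - z) hu hone hPu
    (by rw [hP1.2, one_smul]) (by
      rw [dotProduct_sub, dotProduct_smul, smul_eq_mul, hm,
        div_mul_cancel₀ _ (dotProduct_pos hu hone).ne', sub_self])
  refine ⟨m, k, fun i => ?_⟩
  have := congrFun hk i
  simp only [Pi.sub_apply, Pi.smul_apply, smul_eq_mul, one_mul, Pi.one_apply, mul_one] at this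
  linarith

lemma nonneg_and_eq_zero_of_add_mulVec_eq (hP : P.IsIrreducible) (hP1 : P ∈ rowStochastic ℝ n)
    {z k : n → ℝ} {m : ℝ} (hz : ∀ i, 0 ≤ z i) (h : ∀ i, z i + (P *ᵥ k) i = m + k i) :
    0 ≤ m ∧ (m = 0 → z = 0) := by
  obtain ⟨u, hu, hPu⟩ := exists_pos_vecMul_eq_pfEigenvalue hP
  rw [pfEigenvalue_of_mem_rowStochastic hP1, one_smul] at hPu
  have hmean := dotProduct_eq_mul_of_add_mulVec_eq hPu h
  have hterm (i) : 0 ≤ u i * z i := mul_nonneg (hu i).le (hz i)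
  refine ⟨nonneg_of_mul_nonneg_left (hmean.symm ▸ Finset.sum_nonneg fun i _ => hterm i)
    (dotProduct_pos hu fun _ => one_pos), fun hm => funext fun i => ?_⟩
  rw [hm, zero_mul] at hmean
  have := (Finset.sum_eq_zero_iff_of_nonneg fun i _ => hterm i).1 hmean i (Finset.mem_univ i)
  exact (mul_eq_zero.1 this).resolve_left (hu i).ne'

lemma exists_eq_add_coboundary_add_centered (hP : P.IsIrreducible) (hP1 : P ∈ rowStochastic ℝ n)
    (f : n → n → ℝ) : ∃ (m : ℝ) (g : n → ℝ) (F : n → n → ℝ),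
      (∀ i j, f i j = m + g i - g j + F i j) ∧ ∀ i, ∑ j, P i j * F i j = 0 := by
  obtain ⟨m, g, hg⟩ := exists_add_mulVec_eq hP hP1 fun i => ∑ j, P i j * f i j
  refine ⟨m, g, fun i j => f i j - m - g i + g j, fun i j => by ring, fun i => ?_⟩
  calc ∑ j, P i j * (f i j - m - g i + g j)
      = ∑ j, P i j * f i j + (P *ᵥ g) i - (m + g i) * ∑ j, P i j := by
        rw [mulVec, dotProduct, Finset.mul_sum, ← Finset.sum_add_distrib, ← Finset.sum_sub_distrib]
        exact Finset.sum_congr rfl fun j _ => by ring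
    _ = 0 := by rw [sum_row_of_mem_rowStochastic hP1, hg, mul_one, sub_self]

lemma pfEigenvalue_expTilt_sub_isLittleO (hP : P.IsIrreducible) (hP1 : P ∈ rowStochastic ℝ n)
    {F : n → n → ℝ} {σ : ℝ} {k : n → ℝ} (hF : ∀ i, ∑ j, P i j * F i j = 0)
    (hk : ∀ i, (∑ j, P i j * (F i j ^ 2 / 2)) + (P *ᵥ k) i = σ + k i) :
    (fun t => pfEigenvalue (expTilt P F t) - (1 + t ^ 2 * σ)) =o[𝓝 0] fun t => t ^ 2 := by
  refine pfEigenvalue_sub_isLittleO (δ := 1 / 2) (w := fun t i => 1 + t ^ 2 * k i)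
    one_half_pos (Eventually.of_forall fun t => isIrreducible_expTilt hP F t) (fun i => ?_)
    fun i => ?_
  · have hlim : Tendsto (fun t : ℝ => 1 + t ^ 2 * k i) (𝓝 0) (𝓝 (1 + 0 ^ 2 * k i)) :=
      Continuous.tendsto (by fun_prop) 0
    exact (hlim.eventually_const_lt (by norm_num)).mono fun _ => le_of_lt
  · have hentries := IsLittleO.sum (s := Finset.univ) fun j _ =>
      (exp_mul_one_add_sub_isLittleO (F i j) (k j)).const_mul_left (P i j)
    have hquartic : (fun t : ℝ => t ^ 4 * (σ * k i)) =o[𝓝 0] fun t => t ^ 2 := by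
      simpa only [mul_comm] using (isLittleO_pow_pow (𝕜 := ℝ) (by norm_num : 2 < 4)).const_mul_left
        (σ * k i)
    refine (hentries.sub hquartic).congr_left fun t => ?_
    have hsum : ∑ j, P i j * (1 + t * F i j + t ^ 2 * (F i j ^ 2 / 2 + k j)) =
        1 + t ^ 2 * (σ + k i) :=
      calc ∑ j, P i j * (1 + t * F i j + t ^ 2 * (F i j ^ 2 / 2 + k j))
          = ∑ j, P i j + t * ∑ j, P i j * F i j +
              t ^ 2 * (∑ j, P i j * (F i j ^ 2 / 2) + (P *ᵥ k) i) := by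
            simp only [mulVec, dotProduct, Finset.mul_sum, ← Finset.sum_add_distrib]
            exact Finset.sum_congr rfl fun j _ => by ring
        _ = 1 + t ^ 2 * (σ + k i) := by
            rw [hF, hk, sum_row_of_mem_rowStochastic hP1, mul_zero, add_zero]
    simp only [Finset.sum_apply, mul_sub, Finset.sum_sub_distrib, hsum, mulVec, dotProduct,
      expTilt_apply, mul_assoc]
    ring

lemma exists_log_pfEigenvalue_expTilt_sub_isLittleO (hP : P.IsIrreducible)
    (hP1 : P ∈ rowStochastic ℝ n) (f : n → n → ℝ) :
    ∃ m σ : ℝ, (fun t => Real.log (pfEigenvalue (expTilt P f t)) - t * m - t ^ 2 * σ) =o[𝓝 0]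
      (fun t => t ^ 2) ∧ 0 ≤ σ ∧ (σ = 0 → IsConstAddCoboundary P f) := by
  obtain ⟨m, g, F, hf, hF⟩ := exists_eq_add_coboundary_add_centered hP hP1 f
  obtain ⟨σ, k, hk⟩ := exists_add_mulVec_eq hP hP1 fun i => ∑ j, P i j * (F i j ^ 2 / 2)
  obtain ⟨hσ, hσ0⟩ := nonneg_and_eq_zero_of_add_mulVec_eq hP hP1 (fun i => Finset.sum_nonneg
    fun j _ => mul_nonneg (hP.nonneg i j) (by positivity)) hk
  refine ⟨m, σ, ?_, hσ, fun h => ⟨m, g, fun i j hij => ?_⟩⟩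
  · have hsq : Tendsto (fun t : ℝ => t ^ 2) (𝓝 0) (𝓝 0) :=
      Continuous.tendsto' (by fun_prop) _ _ (by simp)
    have hσO : (fun t : ℝ => t ^ 2 * σ) =O[𝓝 0] fun t => t ^ 2 := by
      simpa only [mul_comm] using isBigO_const_mul_self σ (fun t : ℝ => t ^ 2) (𝓝 0)
    refine (log_sub_isLittleO hsq hσO
      (pfEigenvalue_expTilt_sub_isLittleO hP hP1 hF hk)).congr_left fun t => ?_
    rw [log_pfEigenvalue_expTilt_of_eq hP fun i j _ => hf i j]
    ring
  · rw [hf, eq_zero_of_sum_mul_sq_eq_zero hP.nonneg (fun i => congrFun (hσ0 h) i) hij, add_zero]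

theorem exists_tendsto_log_pfEigenvalue_expTilt (hA : A.IsIrreducible) (f : n → n → ℝ) :
    ∃ m σ : ℝ, Tendsto (fun t => (Real.log (pfEigenvalue (expTilt A f t)) -
        Real.log (pfEigenvalue A) - t * m) / t ^ 2) (𝓝[≠] 0) (𝓝 σ) ∧
      0 ≤ σ ∧ (σ = 0 ↔ IsConstAddCoboundary A f) := by
  obtain ⟨gA, P, hP1, hP, hAP⟩ := exists_rowStochastic_diagConj hA
  obtain ⟨m, σ, hlittle, hσ, hσ0⟩ := exists_log_pfEigenvalue_expTilt_sub_isLittleO hP hP1 f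
  have hlim : Tendsto (fun t => (Real.log (pfEigenvalue (expTilt A f t)) -
      Real.log (pfEigenvalue A) - t * m) / t ^ 2) (𝓝[≠] 0) (𝓝 σ) := by
    have := (hlittle.mono (nhdsWithin_le_nhds (s := {0}ᶜ))).tendsto_div_nhds_zero.add_const σ
    rw [zero_add] at this
    refine this.congr' (eventually_mem_nhdsWithin.mono fun t (ht : t ≠ 0) => ?_)
    have hlog : Real.log (pfEigenvalue (expTilt A f t)) =
        Real.log (pfEigenvalue A) + Real.log (pfEigenvalue (expTilt P f t)) := by
      conv_lhs => rw [hAP, expTilt_diagConj,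
        log_pfEigenvalue_diagConj (isIrreducible_expTilt hP f t)]
    simp only [hlog]
    field_simp
    ring
  refine ⟨m, σ, hlim, hσ, fun h => ?_, fun h => ?_⟩
  · obtain ⟨c, g, hf⟩ := hσ0 h
    refine ⟨c, g, fun i j hij => hf i j ?_⟩
    rw [hAP, diagConj_apply] at hij
    exact pos_of_mul_pos_right hij (Real.exp_nonneg _)
  · obtain ⟨c, hc⟩ := h.exists_log_pfEigenvalue_eq hA
    -- The quotient is now odd in `t`, so its limit is its own negative.
    have hneg : Tendsto (fun t : ℝ => -t) (𝓝[≠] 0) (𝓝[≠] 0) := by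
      simpa using (hasDerivAt_neg (0 : ℝ)).tendsto_nhdsNE (by simp)
    have hodd := (hlim.comp hneg).congr fun t =>
      show _ = -((Real.log (pfEigenvalue (expTilt A f t)) - Real.log (pfEigenvalue A) - t * m) /
          t ^ 2) by
      simp only [Function.comp_apply, hc]
      ring
    linarith [tendsto_nhds_unique hodd hlim.neg]

end SecondOrder

section OneVariable

lemma concaveOn_Ici_of_Ioi {F : ℝ → ℝ} {a : ℝ} (hF : ConcaveOn ℝ (Ioi a) F)
    (ha : Tendsto F (𝓝[>] a) (𝓝 (F a))) : ConcaveOn ℝ (Ici a) F := by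
  refine concaveOn_of_slope_anti_adjacent (convex_Ici a) fun {x y z} hx _ hxy hyz => ?_
  have hslope (u : ℝ) (hu : a < u) (huy : u < y) :
      (F z - F y) / (z - y) ≤ (F y - F u) / (y - u) :=
    hF.slope_anti_adjacent hu (hu.trans (huy.trans hyz)) huy hyz
  rcases (mem_Ici.1 hx).eq_or_lt with rfl | hx
  · refine ge_of_tendsto ((tendsto_const_nhds.sub ha).div (tendsto_const_nhds.sub
      (tendsto_id.mono_left nhdsWithin_le_nhds)) (sub_pos.2 hxy).ne') ?_
    filter_upwards [Ioo_mem_nhdsGT hxy] with u hu using hslope u hu.1 hu.2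
  · exact hslope x hx hxy

lemma strictConcaveOn_Ici_of_Ioi {F : ℝ → ℝ} {a : ℝ} (hF : StrictConcaveOn ℝ (Ioi a) F)
    (ha : Tendsto F (𝓝[>] a) (𝓝 (F a))) : StrictConcaveOn ℝ (Ici a) F := by
  refine strictConcaveOn_of_slope_strict_anti_adjacent (convex_Ici a) fun {x y z} hx _ hxy hyz => ?_
  obtain ⟨u, hxu, huy⟩ := exists_between hxy
  have hau : a < u := (mem_Ici.1 hx).trans_lt hxu
  calc (F z - F y) / (z - y)
      < (F y - F u) / (y - u) :=
        hF.slope_anti_adjacent hau (hau.trans (huy.trans hyz)) huy hyz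
    _ ≤ (F y - F x) / (y - x) := by
        have := (concaveOn_Ici_of_Ioi hF.concaveOn ha).neg.secant_mono
          (hau.trans huy).le hx hau.le hxy.ne huy.ne hxu.le
        simp only [Pi.neg_apply] at this
        rw [← neg_sub (F x), ← neg_sub (F u), ← neg_sub x, ← neg_sub u, neg_div_neg_eq,
          neg_div_neg_eq]
        rw [neg_sub_neg, neg_sub_neg, ← neg_sub (F x), ← neg_sub (F u), neg_div, neg_div] at this
        linarith

lemma strictAntiOn_of_diff_singleton {h : ℝ → ℝ} {s : Set ℝ} (hs : s.OrdConnected) {a : ℝ}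
    (h_anti : AntitoneOn h s) (h_strict : StrictAntiOn h (s \ {a})) : StrictAntiOn h s := by
  intro x hx y hy hxy
  obtain ⟨u, ⟨hu, hua⟩, v, ⟨hv, hva⟩, huv⟩ :=
    ((Ioo_infinite hxy).sdiff (finite_singleton a)).nontrivial.exists_lt
  have hus := hs.out hx hy (Ioo_subset_Icc_self hu)
  have hvs := hs.out hx hy (Ioo_subset_Icc_self hv)
  calc h y ≤ h v := h_anti hvs hy hv.2.le
    _ < h u := h_strict ⟨hus, hua⟩ ⟨hvs, hva⟩ huv
    _ ≤ h x := h_anti hx hus hu.1.le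

lemma antitoneOn_insert_of_continuousWithinAt {h : ℝ → ℝ} {s : Set ℝ} {a : ℝ}
    (h_anti : AntitoneOn h s) (ha : ClusterPt a (𝓟 s)) (hc : ContinuousWithinAt h s a) :
    AntitoneOn h (insert a s) := by
  simpa using (h_anti.neg.insert_of_continuousWithinAt ha hc.neg).neg

lemma antitoneOn_of_concaveOn_mul {h : ℝ → ℝ} {s : Set ℝ} (hs : s ∈ 𝓝 0)
    (hF : ConcaveOn ℝ s fun θ => θ * h θ) (h0 : ContinuousAt h 0) : AntitoneOn h s := by
  have hdiff : AntitoneOn h (s \ {0}) := fun x ⟨hx, hx0⟩ y ⟨hy, hy0⟩ hxy => by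
    have := hF.neg.secant_mono (mem_of_mem_nhds hs) hx hy hx0 hy0 hxy
    simp only [Pi.neg_apply, zero_mul, neg_zero, sub_zero, neg_div] at this
    rwa [mul_div_cancel_left₀ _ hx0, mul_div_cancel_left₀ _ hy0, neg_le_neg_iff] at this
  have hcluster : ClusterPt 0 (𝓟 (s \ {0})) := by
    change (𝓝[s ∩ {0}ᶜ] 0).NeBot
    rw [nhdsWithin_inter_of_mem (mem_nhdsWithin_of_mem_nhds hs)]
    infer_instance
  simpa [insert_eq_of_mem (mem_of_mem_nhds hs)] using
    antitoneOn_insert_of_continuousWithinAt hdiff hcluster h0.continuousWithinAt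

lemma strictAntiOn_of_strictConcaveOn_mul {h : ℝ → ℝ} {s : Set ℝ} (hs : s ∈ 𝓝 0)
    (hF : StrictConcaveOn ℝ s fun θ => θ * h θ) (h0 : ContinuousAt h 0) : StrictAntiOn h s := by
  refine strictAntiOn_of_diff_singleton (a := 0) hF.1.ordConnected
    (antitoneOn_of_concaveOn_mul hs hF.concaveOn h0) ?_
  intro x ⟨hx, hx0⟩ y ⟨hy, hy0⟩ hxy
  have := hF.secant_strict_mono (mem_of_mem_nhds hs) hx hy hx0 hy0 hxy
  simp only [zero_mul, sub_zero] at this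
  rwa [mul_div_cancel_left₀ _ hx0, mul_div_cancel_left₀ _ hy0] at this

lemma exists_tendsto_nhdsGT_of_antitoneOn {h : ℝ → ℝ} {a C : ℝ} (ha : a < 0)
    (h_anti : AntitoneOn h (Ioi a)) (hC : ∀ θ, a < θ → θ < 0 → -C ≤ θ * h θ) :
    ∃ L, Tendsto h (𝓝[>] a) (𝓝 L) := by
  refine ⟨_, AntitoneOn.tendsto_nhdsWithin_Ioo_right (y := a / 2) (nonempty_Ioo.2 (by linarith))
    (h_anti.mono Ioo_subset_Ioi_self) ⟨|C| / (-a / 2), ?_⟩⟩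
  rintro _ ⟨θ, ⟨haθ, hθa⟩, rfl⟩
  have hbound : -θ * h θ ≤ |C| := by linarith [hC θ haθ (by linarith), le_abs_self C]
  rw [le_div_iff₀ (by linarith)]
  nlinarith [abs_nonneg C]

/-- The behaviour on an interval `s` shared by the Rényi entropies, as functions `h` of `θ`, the
order minus `1`: `θ ↦ θ * h θ` is concave and `h` is non-increasing, and each of them strictly so
exactly when `p` holds. -/
structure IsEntropyCurve (s : Set ℝ) (h : ℝ → ℝ) (p : Prop) : Prop where
  concaveOn : ConcaveOn ℝ s fun θ => θ * h θ
  strictConcaveOn_iff : StrictConcaveOn ℝ s (fun θ => θ * h θ) ↔ p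
  antitoneOn : AntitoneOn h s
  strictAntiOn_iff : StrictAntiOn h s ↔ p

variable {φ h : ℝ → ℝ} {p : Prop} {a : ℝ}

lemma isEntropyCurve_Ioi (ha : a < 0) (hφ : ConvexOn ℝ (Ioi a) φ)
    (hh : ∀ θ, a < θ → θ * h θ = -φ θ) (h0 : ContinuousAt h 0)
    (hstrict : p → StrictConvexOn ℝ (Ioi a) φ)
    (hlinear : ¬p → ∃ c : ℝ, ∀ θ, a < θ → φ θ = θ * c) : IsEntropyCurve (Ioi a) h p := by
  have hF : EqOn (-φ) (fun θ => θ * h θ) (Ioi a) := fun θ hθ => (hh θ hθ).symm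
  have hconcave : ConcaveOn ℝ (Ioi a) fun θ => θ * h θ := hφ.neg.congr hF
  have hconcave_strict (hp : p) : StrictConcaveOn ℝ (Ioi a) fun θ => θ * h θ :=
    (hstrict hp).neg.congr hF
  have hp_of_anti (hs : StrictAntiOn h (Ioi a)) : p := by
    by_contra hp
    obtain ⟨c, hc⟩ := hlinear hp
    have hconst (θ : ℝ) (hθ : 0 < θ) : h θ = -c := by
      have := (hh θ (ha.trans hθ)).trans (congrArg Neg.neg (hc θ (ha.trans hθ)))
      rwa [← mul_neg, mul_right_inj' hθ.ne'] at this
    have := hs (ha.trans one_pos) (ha.trans two_pos) one_lt_two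
    rw [hconst 1 one_pos, hconst 2 two_pos] at this
    exact this.false
  have hanti_of_concave (hs : StrictConcaveOn ℝ (Ioi a) fun θ => θ * h θ) :=
    strictAntiOn_of_strictConcaveOn_mul (Ioi_mem_nhds ha) hs h0
  exact ⟨hconcave, ⟨fun hs => hp_of_anti (hanti_of_concave hs), hconcave_strict⟩,
    antitoneOn_of_concaveOn_mul (Ioi_mem_nhds ha) hconcave h0,
    ⟨hp_of_anti, fun hp => hanti_of_concave (hconcave_strict hp)⟩⟩

lemma IsEntropyCurve.Ici_of_Ioi (hh : IsEntropyCurve (Ioi a) h p)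
    (ha : Tendsto h (𝓝[>] a) (𝓝 (h a))) : IsEntropyCurve (Ici a) h p := by
  have hF : Tendsto (fun θ => θ * h θ) (𝓝[>] a) (𝓝 (a * h a)) :=
    (tendsto_id.mono_left nhdsWithin_le_nhds).mul ha
  have hanti : AntitoneOn h (Ici a) := by
    simpa [Ioi_insert] using
      antitoneOn_insert_of_continuousWithinAt hh.antitoneOn
        (mem_closure_iff_clusterPt.1 (by simp)) ha
  exact ⟨concaveOn_Ici_of_Ioi hh.concaveOn hF,
    ⟨fun hs => hh.strictConcaveOn_iff.1 (hs.subset Ioi_subset_Ici_self (convex_Ioi a)),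
      fun hp => strictConcaveOn_Ici_of_Ioi (hh.strictConcaveOn_iff.2 hp) hF⟩,
    hanti,
    ⟨fun hs => hh.strictAntiOn_iff.1 (hs.mono Ioi_subset_Ici_self), fun hp =>
      strictAntiOn_of_diff_singleton ordConnected_Ici hanti
        (a := a) (by simpa using hh.strictAntiOn_iff.2 hp)⟩⟩

lemma hasDerivAt_zero_of_tendsto_div_sq {m σ : ℝ} (hφ0 : φ 0 = 0)
    (h : Tendsto (fun t => (φ t - t * m) / t ^ 2) (𝓝[≠] 0) (𝓝 σ)) : HasDerivAt φ m 0 := by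
  rw [hasDerivAt_iff_tendsto_slope]
  have := ((tendsto_id.mono_left nhdsWithin_le_nhds).mul h).add_const m
  rw [zero_mul, zero_add] at this
  refine this.congr' (eventually_mem_nhdsWithin.mono fun t (ht : t ≠ 0) => ?_)
  rw [slope_def_field, hφ0, id]
  field_simp
  ring

lemma tendsto_neg_div_of_hasDerivAt {φ : ℝ → ℝ} {d : ℝ} (h0 : φ 0 = 0) (hd : HasDerivAt φ d 0) :
    Tendsto (fun t => -(1 / t) * φ t) (𝓝[≠] 0) (𝓝 (-d)) := by
  refine (hasDerivAt_iff_tendsto_slope.1 hd).neg.congr fun t => ?_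
  rw [slope_def_field, h0]
  ring

/-- The function `θ ↦ -φ θ / θ`, extended to `θ = 0` and `θ = -1` by its limits. -/
noncomputable def entropyOf (φ : ℝ → ℝ) (θ : ℝ) : ℝ :=
  let f : ℝ → ℝ := fun t => -(1 / t) * φ t
  if θ = 0 then limUnder (𝓝[≠] 0) f
  else if θ = -1 then limUnder (𝓝[>] (-1)) f
  else f θ

lemma entropyOf_of_ne {θ : ℝ} (h0 : θ ≠ 0) (h1 : θ ≠ -1) : entropyOf φ θ = -(1 / θ) * φ θ := by
  simp only [entropyOf, if_neg h0, if_neg h1]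

lemma entropyOf_congr {ψ : ℝ → ℝ} (h : ∀ θ, -1 < θ → φ θ = ψ θ) {θ : ℝ} (hθ : -1 < θ) :
    entropyOf φ θ = entropyOf ψ θ := by
  rcases eq_or_ne θ 0 with rfl | h0
  · simp only [entropyOf, if_true, limUnder]
    refine congrArg lim (Filter.map_congr ?_)
    filter_upwards [nhdsWithin_le_nhds (Ioi_mem_nhds neg_one_lt_zero)] with t ht
    rw [h t ht]
  · rw [entropyOf_of_ne h0 hθ.ne', entropyOf_of_ne h0 hθ.ne', h θ hθ]

lemma mul_entropyOf (hφ0 : φ 0 = 0) {θ : ℝ} (hθ : θ ≠ -1) : θ * entropyOf φ θ = -φ θ := by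
  rcases eq_or_ne θ 0 with rfl | h0
  · rw [hφ0, zero_mul, neg_zero]
  · rw [entropyOf_of_ne h0 hθ]
    field_simp

lemma entropyOf_zero {d : ℝ} (hφ0 : φ 0 = 0) (hφ : HasDerivAt φ d 0) : entropyOf φ 0 = -d := by
  simp only [entropyOf, if_true]
  exact (tendsto_neg_div_of_hasDerivAt hφ0 hφ).limUnder_eq

lemma continuousAt_entropyOf_zero {d : ℝ} (hφ0 : φ 0 = 0) (hφ : HasDerivAt φ d 0) :
    ContinuousAt (entropyOf φ) 0 := by
  rw [← continuousWithinAt_compl_self, ContinuousWithinAt, entropyOf_zero hφ0 hφ]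
  refine (tendsto_neg_div_of_hasDerivAt hφ0 hφ).congr' ?_
  filter_upwards [self_mem_nhdsWithin,
    nhdsWithin_le_nhds (isOpen_ne.mem_nhds (by norm_num : (0 : ℝ) ≠ -1))] with t ht ht'
  rw [entropyOf_of_ne ht ht']

lemma tendsto_entropyOf_sub_div {m σ : ℝ} (hφ0 : φ 0 = 0)
    (h : Tendsto (fun t => (φ t - t * m) / t ^ 2) (𝓝[≠] 0) (𝓝 σ)) :
    Tendsto (fun t => 2 * (entropyOf φ 0 - entropyOf φ t) / t) (𝓝[≠] 0) (𝓝 (2 * σ)) := by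
  refine (h.const_mul 2).congr' ?_
  filter_upwards [self_mem_nhdsWithin,
    nhdsWithin_le_nhds (isOpen_ne.mem_nhds (by norm_num : (0 : ℝ) ≠ -1))] with t ht ht'
  have ht : t ≠ 0 := ht
  rw [entropyOf_zero hφ0 (hasDerivAt_zero_of_tendsto_div_sq hφ0 h), entropyOf_of_ne ht ht']
  field_simp
  ring

lemma isEntropyCurve_entropyOf {d : ℝ} (hφ0 : φ 0 = 0) (hφd : HasDerivAt φ d 0)
    (hφ : ConvexOn ℝ (Ioi (-1)) φ) (hstrict : p → StrictConvexOn ℝ (Ioi (-1)) φ)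
    (hlinear : ¬p → ∃ c : ℝ, ∀ θ, -1 < θ → φ θ = θ * c) :
    IsEntropyCurve (Ioi (-1)) (entropyOf φ) p :=
  isEntropyCurve_Ioi neg_one_lt_zero hφ (fun _ hθ => mul_entropyOf hφ0 hθ.ne')
    (continuousAt_entropyOf_zero hφ0 hφd) hstrict hlinear

lemma tendsto_entropyOf_neg_one {C : ℝ} (hφ0 : φ 0 = 0)
    (h_anti : AntitoneOn (entropyOf φ) (Ioi (-1))) (hC : ∀ θ, -1 < θ → θ < 0 → φ θ ≤ C) :
    Tendsto (entropyOf φ) (𝓝[>] (-1)) (𝓝 (entropyOf φ (-1))) := by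
  obtain ⟨L, hL⟩ := exists_tendsto_nhdsGT_of_antitoneOn neg_one_lt_zero h_anti (C := C)
    fun θ hθ hθ0 => by rw [mul_entropyOf hφ0 hθ.ne', neg_le_neg_iff]; exact hC θ hθ hθ0
  have hL' : Tendsto (fun t => -(1 / t) * φ t) (𝓝[>] (-1)) (𝓝 L) := by
    refine hL.congr' ?_
    filter_upwards [Ioo_mem_nhdsGT neg_one_lt_zero] with t ht
    rw [entropyOf_of_ne ht.2.ne ht.1.ne']
  have : entropyOf φ (-1) = L := by
    simp only [entropyOf, if_true, if_neg (neg_ne_zero.2 (one_ne_zero (α := ℝ)))]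
    exact hL'.limUnder_eq
  rwa [this]

end OneVariable

section LowerEntropy

open Matrix

lemma log_pfEigenvalue_of_mem_colStochastic {n : Type*} [Fintype n] [DecidableEq n] [Nonempty n]
    {A : Matrix n n ℝ} (hA : A ∈ colStochastic ℝ n) : Real.log (pfEigenvalue A) = 0 := by
  rw [pfEigenvalue_of_mem_colStochastic hA, Real.log_one]

lemma log_pfEigenvalue_le_log_card_mul {n : Type*} [Fintype n] [DecidableEq n] [Nonempty n]
    {A : Matrix n n ℝ} (hA : A.IsIrreducible) {c : ℝ} (h : ∀ i j, A i j ≤ c) :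
    Real.log (pfEigenvalue A) ≤ Real.log (Fintype.card n * c) := by
  refine Real.log_le_log (pfEigenvalue_pos hA)
    (pfEigenvalue_le hA.nonneg (v := 1) (fun _ => one_pos) fun i => ?_)
  simpa [mulVec, dotProduct] using Finset.sum_le_sum fun j (_ : j ∈ Finset.univ) => h i j

variable {X Y : Type*} [Fintype X] [Nonempty X] {W : Matrix (X × Y) (X × Y) ℝ}

lemma marginal_nonneg (hW : ∀ s s', 0 ≤ W s s') (y y' : Y) : 0 ≤ marginal W y y' :=
  Finset.sum_nonneg fun _ _ => hW _ _

lemma NonHidden.sum_eq_marginal (nh : NonHidden W) (x' : X) (y y' : Y) :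
    ∑ x, W (x, y) (x', y') = marginal W y y' := nh y y' _ _

lemma NonHidden.marginal_pos (nh : NonHidden W) (hW : ∀ s s', 0 ≤ W s s') {s s' : X × Y}
    (h : 0 < W s s') : 0 < marginal W s.2 s'.2 := by
  rw [← nh.sum_eq_marginal s'.1]
  exact h.trans_le (Finset.single_le_sum (f := fun x => W (x, s.2) (s'.1, s'.2))
    (fun _ _ => hW _ _) (Finset.mem_univ s.1))

/-- The information increment `log W(x, y | x', y') - log W(y | y')` of a transition: `tilted W θ`
is the exponential tilt of `W` along it. -/
noncomputable def increment (W : Matrix (X × Y) (X × Y) ℝ) (s s' : X × Y) : ℝ :=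
  Real.log (W s s') - Real.log (marginal W s.2 s'.2)

lemma NonHidden.tilted_eq_expTilt (nh : NonHidden W) (hW : ∀ s s', 0 ≤ W s s') {θ : ℝ}
    (hθ : -1 < θ) : tilted W θ = expTilt W (increment W) θ := by
  ext s s'
  rw [expTilt_apply, tilted, of_apply]
  rcases (hW s s').eq_or_lt with h | h
  · rw [← h, Real.zero_rpow (by linarith), zero_mul, zero_mul]
  · rw [Real.rpow_add h, Real.rpow_one, Real.rpow_def_of_pos h,
      Real.rpow_def_of_pos (nh.marginal_pos hW h), mul_assoc, ← Real.exp_add, increment]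
    ring_nf

lemma NonHidden.isIrreducible_marginal (nh : NonHidden W) (hirr : W.IsIrreducible) :
    (marginal W).IsIrreducible :=
  isIrreducible_of_map Prod.snd_surjective hirr (marginal_nonneg hirr.nonneg)
    fun _ _ => nh.marginal_pos hirr.nonneg

variable [DecidableEq X] [Fintype Y] [DecidableEq Y]

lemma marginal_mem_colStochastic (hW : W ∈ colStochastic ℝ (X × Y)) :
    marginal W ∈ colStochastic ℝ Y := by
  rw [mem_colStochastic_iff_sum] at hW ⊢
  refine ⟨marginal_nonneg hW.1, fun y' => ?_⟩
  rw [← hW.2 (Classical.arbitrary X, y'), Fintype.sum_prod_type_right]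
  rfl

variable [Nonempty Y]

lemma NonHidden.log_pfEigenvalue_tilted_zero (nh : NonHidden W) (hirr : W.IsIrreducible)
    (hW : W ∈ colStochastic ℝ (X × Y)) : Real.log (pfEigenvalue (tilted W 0)) = 0 := by
  rw [nh.tilted_eq_expTilt hirr.nonneg neg_one_lt_zero, expTilt_zero,
    log_pfEigenvalue_of_mem_colStochastic hW]

lemma NonHidden.convexOn_log_pfEigenvalue_tilted (nh : NonHidden W) (hirr : W.IsIrreducible) :
    ConvexOn ℝ (Ioi (-1)) fun θ => Real.log (pfEigenvalue (tilted W θ)) :=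
  ((convexOn_log_pfEigenvalue_expTilt hirr (increment W)).subset (subset_univ _)
    (convex_Ioi _)).congr fun θ (hθ : -1 < θ) => by
      simp only [nh.tilted_eq_expTilt hirr.nonneg hθ]

lemma NonHidden.strictConvexOn_log_pfEigenvalue_tilted (nh : NonHidden W)
    (hirr : W.IsIrreducible) (hf : ¬IsConstAddCoboundary W (increment W)) :
    StrictConvexOn ℝ (Ioi (-1)) fun θ => Real.log (pfEigenvalue (tilted W θ)) :=
  ((strictConvexOn_log_pfEigenvalue_expTilt hirr hf).subset (subset_univ _)
    (convex_Ioi _)).congr fun θ (hθ : -1 < θ) => by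
      simp only [nh.tilted_eq_expTilt hirr.nonneg hθ]

lemma NonHidden.exists_log_pfEigenvalue_tilted_eq (nh : NonHidden W) (hirr : W.IsIrreducible)
    (hW : W ∈ colStochastic ℝ (X × Y)) (hf : IsConstAddCoboundary W (increment W)) :
    ∃ c : ℝ, ∀ θ, -1 < θ → Real.log (pfEigenvalue (tilted W θ)) = θ * c := by
  obtain ⟨c, hc⟩ := hf.exists_log_pfEigenvalue_eq hirr
  refine ⟨c, fun θ hθ => ?_⟩
  rw [nh.tilted_eq_expTilt hirr.nonneg hθ, hc, log_pfEigenvalue_of_mem_colStochastic hW, add_zero]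

lemma NonHidden.log_pfEigenvalue_tilted_le (nh : NonHidden W) (hirr : W.IsIrreducible)
    (hW : W ∈ colStochastic ℝ (X × Y)) {θ : ℝ} (h₁ : -1 < θ) (h₂ : θ < 0) :
    Real.log (pfEigenvalue (tilted W θ)) ≤ Real.log (Fintype.card (X × Y)) := by
  have htilted : (tilted W θ).IsIrreducible := by
    rw [nh.tilted_eq_expTilt hirr.nonneg h₁]
    exact isIrreducible_expTilt hirr _ _
  rw [← mul_one (Fintype.card (X × Y) : ℝ)]
  exact log_pfEigenvalue_le_log_card_mul htilted fun s s' => mul_le_one₀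
    (Real.rpow_le_one (hirr.nonneg s s') (le_one_of_mem_colStochastic hW) (by linarith))
    (Real.rpow_nonneg (marginal_nonneg hirr.nonneg _ _) _)
    (Real.rpow_le_one (marginal_nonneg hirr.nonneg _ _)
      (le_one_of_mem_colStochastic (marginal_mem_colStochastic hW)) (by linarith))

lemma NonHidden.exists_tendsto_log_pfEigenvalue_tilted (nh : NonHidden W) (hirr : W.IsIrreducible)
    (hW : W ∈ colStochastic ℝ (X × Y)) :
    ∃ m σ : ℝ, Tendsto (fun θ => (Real.log (pfEigenvalue (tilted W θ)) - θ * m) / θ ^ 2) (𝓝[≠] 0)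
      (𝓝 σ) ∧ 0 ≤ σ ∧ (σ = 0 ↔ IsConstAddCoboundary W (increment W)) := by
  obtain ⟨m, σ, hlim, hσ⟩ := exists_tendsto_log_pfEigenvalue_expTilt hirr (increment W)
  refine ⟨m, σ, hlim.congr' ?_, hσ⟩
  filter_upwards [nhdsWithin_le_nhds (Ioi_mem_nhds neg_one_lt_zero)] with θ hθ
  rw [nh.tilted_eq_expTilt hirr.nonneg hθ, log_pfEigenvalue_of_mem_colStochastic hW, sub_zero]

lemma NonHidden.exists_hasDerivAt_log_pfEigenvalue_tilted (nh : NonHidden W)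
    (hirr : W.IsIrreducible) (hW : W ∈ colStochastic ℝ (X × Y)) :
    ∃ d, HasDerivAt (fun θ => Real.log (pfEigenvalue (tilted W θ))) d 0 := by
  obtain ⟨m, σ, hlim, -⟩ := nh.exists_tendsto_log_pfEigenvalue_tilted hirr hW
  exact ⟨m, hasDerivAt_zero_of_tendsto_div_sq (nh.log_pfEigenvalue_tilted_zero hirr hW) hlim⟩

lemma NonHidden.exists_tendsto_varianceQuotient (nh : NonHidden W) (hirr : W.IsIrreducible)
    (hW : W ∈ colStochastic ℝ (X × Y)) : ∃ V, Tendsto (varianceQuotient W) (𝓝[≠] 0) (𝓝 V) ∧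
      (0 < V ↔ ¬IsConstAddCoboundary W (increment W)) := by
  obtain ⟨m, σ, hlim, hσ, hσ0⟩ := nh.exists_tendsto_log_pfEigenvalue_tilted hirr hW
  refine ⟨2 * σ, tendsto_entropyOf_sub_div (nh.log_pfEigenvalue_tilted_zero hirr hW) hlim, ?_⟩
  rw [mul_pos_iff_of_pos_left two_pos, ← hσ0, hσ.lt_iff_ne', ne_eq]

lemma NonHidden.tendsto_varianceQuotient (nh : NonHidden W) (hirr : W.IsIrreducible)
    (hW : W ∈ colStochastic ℝ (X × Y)) :
    Tendsto (varianceQuotient W) (𝓝[≠] 0) (𝓝 (condVariance W)) :=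
  tendsto_nhds_limUnder ((nh.exists_tendsto_varianceQuotient hirr hW).imp fun _ => And.left)

lemma NonHidden.condVariance_pos_iff (nh : NonHidden W) (hirr : W.IsIrreducible)
    (hW : W ∈ colStochastic ℝ (X × Y)) :
    0 < condVariance W ↔ ¬IsConstAddCoboundary W (increment W) := by
  obtain ⟨V, hV, hpos⟩ := nh.exists_tendsto_varianceQuotient hirr hW
  rwa [tendsto_nhds_unique (nh.tendsto_varianceQuotient hirr hW) hV]

lemma NonHidden.tendsto_lowerEntropy_zero (nh : NonHidden W) (hirr : W.IsIrreducible)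
    (hW : W ∈ colStochastic ℝ (X × Y)) :
    Tendsto (lowerEntropy W) (𝓝[≠] 0) (𝓝 (lowerEntropy W 0)) := by
  obtain ⟨d, hd⟩ := nh.exists_hasDerivAt_log_pfEigenvalue_tilted hirr hW
  exact (continuousAt_entropyOf_zero
    (nh.log_pfEigenvalue_tilted_zero hirr hW) hd).continuousWithinAt

lemma NonHidden.isEntropyCurve_lowerEntropy_Ioi (nh : NonHidden W) (hirr : W.IsIrreducible)
    (hW : W ∈ colStochastic ℝ (X × Y)) :
    IsEntropyCurve (Ioi (-1)) (lowerEntropy W) (0 < condVariance W) := by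
  obtain ⟨d, hd⟩ := nh.exists_hasDerivAt_log_pfEigenvalue_tilted hirr hW
  rw [nh.condVariance_pos_iff hirr hW]
  exact isEntropyCurve_entropyOf (nh.log_pfEigenvalue_tilted_zero hirr hW) hd
    (nh.convexOn_log_pfEigenvalue_tilted hirr) (nh.strictConvexOn_log_pfEigenvalue_tilted hirr)
    fun hf => nh.exists_log_pfEigenvalue_tilted_eq hirr hW (not_not.1 hf)

lemma NonHidden.tendsto_lowerEntropy_neg_one (nh : NonHidden W) (hirr : W.IsIrreducible)
    (hW : W ∈ colStochastic ℝ (X × Y)) :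
    Tendsto (lowerEntropy W) (𝓝[>] (-1)) (𝓝 (lowerEntropy W (-1))) :=
  tendsto_entropyOf_neg_one (nh.log_pfEigenvalue_tilted_zero hirr hW)
    (nh.isEntropyCurve_lowerEntropy_Ioi hirr hW).antitoneOn
    fun _ => nh.log_pfEigenvalue_tilted_le hirr hW

theorem NonHidden.isEntropyCurve_lowerEntropy (nh : NonHidden W) (hirr : W.IsIrreducible)
    (hW : W ∈ colStochastic ℝ (X × Y)) :
    IsEntropyCurve (Ici (-1)) (lowerEntropy W) (0 < condVariance W) :=
  (nh.isEntropyCurve_lowerEntropy_Ioi hirr hW).Ici_of_Ioi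
    (nh.tendsto_lowerEntropy_neg_one hirr hW)

end LowerEntropy

section PowerMarginal

open Matrix

variable {X Y : Type*} [Fintype X] {W : Matrix (X × Y) (X × Y) ℝ} {ℓ : Y → Y → ℝ}
  {θ θ₁ θ₂ a b : ℝ}

lemma StronglyNonHidden.nonHidden (snh : StronglyNonHidden W) : NonHidden W := fun y y' x₁ x₂ => by
  simpa only [add_zero, Real.rpow_one] using snh 0 neg_one_lt_zero y y' x₁ x₂

variable [Nonempty X]

lemma powerMarginal_zero (W : Matrix (X × Y) (X × Y) ℝ) : powerMarginal W 0 = marginal W := by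
  simp only [powerMarginal, marginal, add_zero, Real.rpow_one]

lemma powerMarginal_nonneg (hW : ∀ s s', 0 ≤ W s s') (θ : ℝ) (y y' : Y) :
    0 ≤ powerMarginal W θ y y' :=
  Finset.sum_nonneg fun _ _ => Real.rpow_nonneg (hW _ _) _

lemma powerMarginal_pos_iff (hW : ∀ s s', 0 ≤ W s s') (hθ : -1 < θ) {y y' : Y} :
    0 < powerMarginal W θ y y' ↔ 0 < marginal W y y' := by
  simp only [powerMarginal, marginal, of_apply]
  rw [Finset.sum_pos_iff_of_nonneg fun _ _ => Real.rpow_nonneg (hW _ _) _,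
    Finset.sum_pos_iff_of_nonneg fun _ _ => hW _ _]
  simp only [(Real.rpow_nonneg (hW _ _) _).lt_iff_ne', (hW _ _).lt_iff_ne', ne_eq,
    Real.rpow_eq_zero (hW _ _) (by linarith : 1 + θ ≠ 0)]

lemma powerMarginal_eq_zero (hW : ∀ s s', 0 ≤ W s s') (hθ : -1 < θ) {y y' : Y}
    (h : marginal W y y' = 0) : powerMarginal W θ y y' = 0 :=
  ((powerMarginal_nonneg hW θ y y').eq_or_lt.resolve_right fun hpos =>
    h.not_gt ((powerMarginal_pos_iff hW hθ).1 hpos)).symm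

lemma StronglyNonHidden.sum_eq_powerMarginal (snh : StronglyNonHidden W) (hθ : -1 < θ) (x' : X)
    (y y' : Y) : ∑ x, W (x, y) (x', y') ^ (1 + θ) = powerMarginal W θ y y' :=
  snh θ hθ y y' _ _

lemma rpow_one_add_convexCombo {w : ℝ} (hw : 0 ≤ w) (ha : 0 < a) (hb : 0 < b) (hab : a + b = 1)
    (h₁ : -1 < θ₁) (h₂ : -1 < θ₂) :
    w ^ (1 + (a * θ₁ + b * θ₂)) = (w ^ (1 + θ₁)) ^ a * (w ^ (1 + θ₂)) ^ b := by
  rw [← Real.rpow_mul hw, ← Real.rpow_mul hw, ← Real.rpow_add_of_nonneg hw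
    (mul_pos (by linarith) ha).le (mul_pos (by linarith) hb).le]
  congr 1
  linear_combination -hab

lemma powerMarginal_convexCombo_le (hW : ∀ s s', 0 ≤ W s s') (ha : 0 < a) (hb : 0 < b)
    (hab : a + b = 1) (h₁ : -1 < θ₁) (h₂ : -1 < θ₂) (y y' : Y) :
    powerMarginal W (a * θ₁ + b * θ₂) y y' ≤
      powerMarginal W θ₁ y y' ^ a * powerMarginal W θ₂ y y' ^ b := by
  rcases (marginal_nonneg hW y y').eq_or_lt with h | h
  · rw [powerMarginal_eq_zero hW (by nlinarith) h.symm]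
    exact mul_nonneg (Real.rpow_nonneg (powerMarginal_nonneg hW _ _ _) _)
      (Real.rpow_nonneg (powerMarginal_nonneg hW _ _ _) _)
  · simp only [powerMarginal, of_apply, rpow_one_add_convexCombo (hW _ _) ha hb hab h₁ h₂]
    exact sum_rpow_mul_rpow_le ha hb hab (fun _ _ => Real.rpow_nonneg (hW _ _) _)
      (fun _ _ => Real.rpow_nonneg (hW _ _) _) ((powerMarginal_pos_iff hW h₁).2 h)
      ((powerMarginal_pos_iff hW h₂).2 h)

/-- The increment of `W` is a function `ℓ` of the `Y`-components alone. This is the equality case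
of the log-convexity of `θ ↦ powerMarginal W θ y y'`. -/
def HasPotential (W : Matrix (X × Y) (X × Y) ℝ) (ℓ : Y → Y → ℝ) : Prop :=
  ∀ s s', 0 < W s s' → increment W s s' = ℓ s.2 s'.2

lemma StronglyNonHidden.exists_hasPotential (snh : StronglyNonHidden W) (hW : ∀ s s', 0 ≤ W s s')
    (ha : 0 < a) (hb : 0 < b) (hab : a + b = 1) (h₁ : -1 < θ₁) (h₂ : -1 < θ₂) (hne : θ₁ ≠ θ₂)
    (h : ∀ y y', powerMarginal W (a * θ₁ + b * θ₂) y y' =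
      powerMarginal W θ₁ y y' ^ a * powerMarginal W θ₂ y y' ^ b) : ∃ ℓ, HasPotential W ℓ := by
  refine ⟨fun y y' => (Real.log (powerMarginal W θ₁ y y') - Real.log (powerMarginal W θ₂ y y')) /
    (θ₁ - θ₂) - Real.log (marginal W y y'), fun ⟨x, y⟩ ⟨x', y'⟩ hpos => ?_⟩
  have hM : 0 < marginal W y y' := snh.nonHidden.marginal_pos hW hpos
  have hP₁ := (powerMarginal_pos_iff hW h₁).2 hM
  have hP₂ := (powerMarginal_pos_iff hW h₂).2 hM
  have hdiv := div_sum_eq_of_sum_rpow_mul_rpow_eq (s := Finset.univ)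
    (p := fun x => W (x, y) (x', y') ^ (1 + θ₁)) (q := fun x => W (x, y) (x', y') ^ (1 + θ₂))
    ha hb hab (fun _ _ => Real.rpow_nonneg (hW _ _) _) (fun _ _ => Real.rpow_nonneg (hW _ _) _)
    (by rwa [snh.sum_eq_powerMarginal h₁]) (by rwa [snh.sum_eq_powerMarginal h₂])
    (by
      simp only [← rpow_one_add_convexCombo (hW _ _) ha hb hab h₁ h₂]
      rw [snh.sum_eq_powerMarginal (by nlinarith), snh.sum_eq_powerMarginal h₁,
        snh.sum_eq_powerMarginal h₂, h]) (Finset.mem_univ x)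
  rw [snh.sum_eq_powerMarginal h₁, snh.sum_eq_powerMarginal h₂] at hdiv
  have hlog := congrArg Real.log hdiv
  rw [Real.log_div (by positivity) hP₁.ne', Real.log_div (by positivity) hP₂.ne',
    Real.log_rpow hpos, Real.log_rpow hpos] at hlog
  rw [increment, sub_left_inj, eq_div_iff (sub_ne_zero.2 hne)]
  linear_combination hlog

lemma HasPotential.powerMarginal_eq (hℓ : HasPotential W ℓ) (hW : ∀ s s', 0 ≤ W s s')
    (hθ : -1 < θ) (y y' : Y) :
    powerMarginal W θ y y' =
      marginal W y y' * Real.exp (θ * (Real.log (marginal W y y') + ℓ y y')) := by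
  rw [marginal, powerMarginal, of_apply, of_apply, Finset.sum_mul]
  refine Finset.sum_congr rfl fun x _ => ?_
  rcases (hW (x, y) (Classical.arbitrary X, y')).eq_or_lt with h | h
  · rw [← h, Real.zero_rpow (by linarith), zero_mul]
  · have hlog := hℓ _ _ h
    rw [increment, sub_eq_iff_eq_add', marginal, of_apply] at hlog
    rw [Real.rpow_one_add' h.le (by linarith), Real.rpow_def_of_pos h, ← hlog, mul_comm θ]

lemma HasPotential.isConstAddCoboundary_increment (hℓ : HasPotential W ℓ) (nh : NonHidden W)
    (hW : ∀ s s', 0 ≤ W s s') (h : IsConstAddCoboundary (marginal W) ℓ) :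
    IsConstAddCoboundary W (increment W) := by
  obtain ⟨c, g, hg⟩ := h
  exact ⟨c, fun s => g s.2, fun s s' hpos =>
    (hℓ s s' hpos).trans (hg _ _ (nh.marginal_pos hW hpos))⟩

end PowerMarginal

section KAndNMatrices

open Matrix

variable {X Y : Type*} [Fintype X] [Nonempty X] {W : Matrix (X × Y) (X × Y) ℝ} {ℓ : Y → Y → ℝ}
  {θ θ' θ₁ θ₂ a b : ℝ}

lemma kMatrix_nonneg (hW : ∀ s s', 0 ≤ W s s') (θ : ℝ) (y y' : Y) : 0 ≤ kMatrix W θ y y' :=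
  Real.rpow_nonneg (powerMarginal_nonneg hW θ y y') _

lemma nMatrix_nonneg (hW : ∀ s s', 0 ≤ W s s') (θ θ' : ℝ) (y y' : Y) : 0 ≤ nMatrix W θ θ' y y' :=
  mul_nonneg (powerMarginal_nonneg hW θ y y') (Real.rpow_nonneg (powerMarginal_nonneg hW θ' y y') _)

lemma kMatrix_zero (W : Matrix (X × Y) (X × Y) ℝ) : kMatrix W 0 = marginal W := by
  ext y y'
  rw [kMatrix, of_apply, powerMarginal_zero, add_zero, div_one, Real.rpow_one]

lemma nMatrix_zero (W : Matrix (X × Y) (X × Y) ℝ) (θ' : ℝ) : nMatrix W 0 θ' = marginal W := by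
  ext y y'
  rw [nMatrix, of_apply, powerMarginal_zero, neg_zero, zero_div, Real.rpow_zero, mul_one]

lemma kMatrix_rpow_one_add (hW : ∀ s s', 0 ≤ W s s') (hθ : -1 < θ) (y y' : Y) :
    kMatrix W θ y y' ^ (1 + θ) = powerMarginal W θ y y' := by
  rw [kMatrix, of_apply, ← Real.rpow_mul (powerMarginal_nonneg hW θ y y'),
    one_div_mul_cancel (by linarith), Real.rpow_one]

lemma nMatrix_eq_mul_kMatrix_rpow (hW : ∀ s s', 0 ≤ W s s') (θ θ' : ℝ) (y y' : Y) :
    nMatrix W θ θ' y y' = powerMarginal W θ y y' * kMatrix W θ' y y' ^ (-θ) := by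
  rw [nMatrix, kMatrix, of_apply, of_apply, ← Real.rpow_mul (powerMarginal_nonneg hW θ' y y')]
  ring_nf

lemma nMatrix_eq_kMatrix_rpow_mul (hW : ∀ s s', 0 ≤ W s s') (hθ : -1 < θ) (θ' : ℝ) (y y' : Y) :
    nMatrix W θ θ' y y' = kMatrix W θ y y' ^ (1 + θ) * kMatrix W θ' y y' ^ (-θ) := by
  rw [nMatrix_eq_mul_kMatrix_rpow hW, kMatrix_rpow_one_add hW hθ]

lemma kMatrix_pos_iff (hW : ∀ s s', 0 ≤ W s s') (hθ : -1 < θ) {y y' : Y} :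
    0 < kMatrix W θ y y' ↔ 0 < marginal W y y' := by
  rw [kMatrix, of_apply, ← powerMarginal_pos_iff hW hθ]
  refine ⟨fun h => (powerMarginal_nonneg hW θ y y').lt_of_ne fun h0 => ?_,
    fun h => Real.rpow_pos_of_pos h _⟩
  rw [← h0, Real.zero_rpow (one_div_ne_zero (by linarith))] at h
  exact h.false

lemma kMatrix_eq_zero (hW : ∀ s s', 0 ≤ W s s') (hθ : -1 < θ) {y y' : Y}
    (h : marginal W y y' = 0) : kMatrix W θ y y' = 0 := by
  rw [kMatrix, of_apply, powerMarginal_eq_zero hW hθ h,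
    Real.zero_rpow (one_div_ne_zero (by linarith))]

lemma nMatrix_eq_zero (hW : ∀ s s', 0 ≤ W s s') (hθ : -1 < θ) (θ' : ℝ) {y y' : Y}
    (h : marginal W y y' = 0) : nMatrix W θ θ' y y' = 0 := by
  rw [nMatrix, of_apply, powerMarginal_eq_zero hW hθ h, zero_mul]

lemma nMatrix_self (hW : ∀ s s', 0 ≤ W s s') (hθ : -1 < θ) : nMatrix W θ θ = kMatrix W θ := by
  ext y y'
  rcases (marginal_nonneg hW y y').eq_or_lt with h | h
  · rw [nMatrix_eq_zero hW hθ θ h.symm, kMatrix_eq_zero hW hθ h.symm]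
  · rw [nMatrix_eq_kMatrix_rpow_mul hW hθ, ← Real.rpow_add ((kMatrix_pos_iff hW hθ).2 h),
      add_neg_cancel_right, Real.rpow_one]

lemma isIrreducible_kMatrix (hM : (marginal W).IsIrreducible) (hW : ∀ s s', 0 ≤ W s s')
    (hθ : -1 < θ) : (kMatrix W θ).IsIrreducible :=
  isIrreducible_of_pos hM (kMatrix_nonneg hW θ) fun _ _ => (kMatrix_pos_iff hW hθ).2

lemma isIrreducible_nMatrix (hM : (marginal W).IsIrreducible) (hW : ∀ s s', 0 ≤ W s s')
    (hθ : -1 < θ) (hθ' : -1 < θ') : (nMatrix W θ θ').IsIrreducible :=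
  isIrreducible_of_pos hM (nMatrix_nonneg hW θ θ') fun _ _ h =>
    mul_pos ((powerMarginal_pos_iff hW hθ).2 h)
      (Real.rpow_pos_of_pos ((powerMarginal_pos_iff hW hθ').2 h) _)

lemma kMatrix_rpow_mul_kMatrix_rpow (hW : ∀ s s', 0 ≤ W s s') (h₁ : -1 < θ₁) (h₂ : -1 < θ₂)
    (r : ℝ) (y y' : Y) :
    kMatrix W θ₁ y y' ^ (a * (1 + θ₁) / r) * kMatrix W θ₂ y y' ^ (b * (1 + θ₂) / r) =
      (powerMarginal W θ₁ y y' ^ a * powerMarginal W θ₂ y y' ^ b) ^ (1 / r) := by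
  have hP₁ := powerMarginal_nonneg hW θ₁ y y'
  have hP₂ := powerMarginal_nonneg hW θ₂ y y'
  have h₁' : 1 + θ₁ ≠ 0 := by linarith
  have h₂' : 1 + θ₂ ≠ 0 := by linarith
  rw [Real.mul_rpow (Real.rpow_nonneg hP₁ _) (Real.rpow_nonneg hP₂ _), kMatrix, kMatrix, of_apply,
    of_apply, ← Real.rpow_mul hP₁, ← Real.rpow_mul hP₂, ← Real.rpow_mul hP₁, ← Real.rpow_mul hP₂]
  congr 2 <;> field_simp

lemma nMatrix_rpow_mul_nMatrix_rpow (hW : ∀ s s', 0 ≤ W s s') (hθ' : -1 < θ') {y y' : Y}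
    (h : 0 < marginal W y y') :
    nMatrix W θ₁ θ' y y' ^ a * nMatrix W θ₂ θ' y y' ^ b =
      powerMarginal W θ₁ y y' ^ a * powerMarginal W θ₂ y y' ^ b *
        kMatrix W θ' y y' ^ (-(a * θ₁ + b * θ₂)) := by
  have hK := (kMatrix_pos_iff hW hθ').2 h
  simp only [nMatrix_eq_mul_kMatrix_rpow hW]
  rw [Real.mul_rpow (powerMarginal_nonneg hW _ _ _) (Real.rpow_nonneg hK.le _),
    Real.mul_rpow (powerMarginal_nonneg hW _ _ _) (Real.rpow_nonneg hK.le _), mul_mul_mul_comm,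
    ← Real.rpow_mul hK.le, ← Real.rpow_mul hK.le, ← Real.rpow_add hK]
  ring_nf

lemma kMatrix_convexCombo_le (hW : ∀ s s', 0 ≤ W s s') (ha : 0 < a) (hb : 0 < b)
    (hab : a + b = 1) (h₁ : -1 < θ₁) (h₂ : -1 < θ₂) (y y' : Y) :
    kMatrix W (a * θ₁ + b * θ₂) y y' ≤
      kMatrix W θ₁ y y' ^ (a * (1 + θ₁) / (1 + (a * θ₁ + b * θ₂))) *
        kMatrix W θ₂ y y' ^ (b * (1 + θ₂) / (1 + (a * θ₁ + b * θ₂))) := by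
  rw [kMatrix_rpow_mul_kMatrix_rpow hW h₁ h₂]
  exact Real.rpow_le_rpow (powerMarginal_nonneg hW _ _ _)
    (powerMarginal_convexCombo_le hW ha hb hab h₁ h₂ y y') (one_div_nonneg.2 (by nlinarith))

lemma nMatrix_convexCombo_le (hW : ∀ s s', 0 ≤ W s s') (ha : 0 < a) (hb : 0 < b)
    (hab : a + b = 1) (h₁ : -1 < θ₁) (h₂ : -1 < θ₂) (hθ' : -1 < θ') (y y' : Y) :
    nMatrix W (a * θ₁ + b * θ₂) θ' y y' ≤
      nMatrix W θ₁ θ' y y' ^ a * nMatrix W θ₂ θ' y y' ^ b := by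
  rcases (marginal_nonneg hW y y').eq_or_lt with h | h
  · rw [nMatrix_eq_zero hW (by nlinarith) θ' h.symm]
    exact mul_nonneg (Real.rpow_nonneg (nMatrix_nonneg hW _ _ _ _) _)
      (Real.rpow_nonneg (nMatrix_nonneg hW _ _ _ _) _)
  · rw [nMatrix_rpow_mul_nMatrix_rpow hW hθ' h, nMatrix_eq_mul_kMatrix_rpow hW]
    exact mul_le_mul_of_nonneg_right (powerMarginal_convexCombo_le hW ha hb hab h₁ h₂ y y')
      (Real.rpow_nonneg (kMatrix_nonneg hW _ _ _) _)

lemma powerMarginal_convexCombo_eq_of_kMatrix (hW : ∀ s s', 0 ≤ W s s') (ha : 0 < a) (hb : 0 < b)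
    (hab : a + b = 1) (h₁ : -1 < θ₁) (h₂ : -1 < θ₂) {y y' : Y}
    (h : kMatrix W (a * θ₁ + b * θ₂) y y' =
      kMatrix W θ₁ y y' ^ (a * (1 + θ₁) / (1 + (a * θ₁ + b * θ₂))) *
        kMatrix W θ₂ y y' ^ (b * (1 + θ₂) / (1 + (a * θ₁ + b * θ₂)))) :
    powerMarginal W (a * θ₁ + b * θ₂) y y' =
      powerMarginal W θ₁ y y' ^ a * powerMarginal W θ₂ y y' ^ b := by
  rw [kMatrix_rpow_mul_kMatrix_rpow hW h₁ h₂, kMatrix, of_apply] at h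
  exact (Real.rpow_left_inj (powerMarginal_nonneg hW _ _ _)
    (mul_nonneg (Real.rpow_nonneg (powerMarginal_nonneg hW _ _ _) _)
      (Real.rpow_nonneg (powerMarginal_nonneg hW _ _ _) _))
    (one_div_ne_zero (by nlinarith))).1 h

lemma powerMarginal_convexCombo_eq_of_nMatrix (hW : ∀ s s', 0 ≤ W s s') (ha : 0 < a) (hb : 0 < b)
    (hab : a + b = 1) (h₁ : -1 < θ₁) (h₂ : -1 < θ₂) (hθ' : -1 < θ') {y y' : Y}
    (h : nMatrix W (a * θ₁ + b * θ₂) θ' y y' =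
      nMatrix W θ₁ θ' y y' ^ a * nMatrix W θ₂ θ' y y' ^ b) :
    powerMarginal W (a * θ₁ + b * θ₂) y y' =
      powerMarginal W θ₁ y y' ^ a * powerMarginal W θ₂ y y' ^ b := by
  rcases (marginal_nonneg hW y y').eq_or_lt with hM | hM
  · rw [powerMarginal_eq_zero hW (by nlinarith) hM.symm, powerMarginal_eq_zero hW h₁ hM.symm,
      Real.zero_rpow ha.ne', zero_mul]
  · rw [nMatrix_rpow_mul_nMatrix_rpow hW hθ' hM, nMatrix_eq_mul_kMatrix_rpow hW] at h
    exact mul_right_cancel₀ (Real.rpow_pos_of_pos ((kMatrix_pos_iff hW hθ').2 hM) _).ne' h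

lemma HasPotential.kMatrix_eq_expTilt (hℓ : HasPotential W ℓ) (hW : ∀ s s', 0 ≤ W s s')
    (hθ : -1 < θ) : kMatrix W θ = expTilt (marginal W) ℓ (θ / (1 + θ)) := by
  ext y y'
  have h1 : 1 + θ ≠ 0 := by linarith
  rcases (marginal_nonneg hW y y').eq_or_lt with h | h
  · rw [kMatrix_eq_zero hW hθ h.symm, expTilt_apply, ← h, zero_mul]
  · rw [kMatrix, of_apply, expTilt_apply, hℓ.powerMarginal_eq hW hθ]
    nth_rewrite 1 3 [← Real.exp_log h]
    rw [← Real.exp_add, ← Real.exp_mul, ← Real.exp_add]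
    congr 1
    field_simp
    ring

lemma HasPotential.nMatrix_eq_expTilt (hℓ : HasPotential W ℓ) (hW : ∀ s s', 0 ≤ W s s')
    (hθ : -1 < θ) (hθ' : -1 < θ') :
    nMatrix W θ θ' = expTilt (marginal W) ℓ (θ / (1 + θ')) := by
  ext y y'
  have h1 : 1 + θ' ≠ 0 := by linarith
  rcases (marginal_nonneg hW y y').eq_or_lt with h | h
  · rw [nMatrix_eq_zero hW hθ θ' h.symm, expTilt_apply, ← h, zero_mul]
  · rw [nMatrix_eq_mul_kMatrix_rpow hW, hℓ.kMatrix_eq_expTilt hW hθ', expTilt_apply,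
      expTilt_apply, hℓ.powerMarginal_eq hW hθ, Real.mul_rpow h.le (Real.exp_nonneg _),
      Real.rpow_def_of_pos h, ← Real.exp_mul, mul_assoc, ← Real.exp_add, ← Real.exp_add]
    congr 2
    field_simp
    ring

end KAndNMatrices

section SpectralConvexity

open Matrix

variable {X Y : Type*} [Fintype X] [Nonempty X] {W : Matrix (X × Y) (X × Y) ℝ} {θ θ' θ₁ θ₂ a b : ℝ}

variable [Fintype Y] [DecidableEq Y] [Nonempty Y]

lemma log_pfEigenvalue_nMatrix_convexCombo_le (hM : (marginal W).IsIrreducible)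
    (hW : ∀ s s', 0 ≤ W s s') (ha : 0 < a) (hb : 0 < b) (hab : a + b = 1) (h₁ : -1 < θ₁)
    (h₂ : -1 < θ₂) (hθ' : -1 < θ') :
    Real.log (pfEigenvalue (nMatrix W (a * θ₁ + b * θ₂) θ')) ≤
      a * Real.log (pfEigenvalue (nMatrix W θ₁ θ')) +
        b * Real.log (pfEigenvalue (nMatrix W θ₂ θ')) :=
  log_pfEigenvalue_le_add (isIrreducible_nMatrix hM hW h₁ hθ') (isIrreducible_nMatrix hM hW h₂ hθ')
    (isIrreducible_nMatrix hM hW (by nlinarith) hθ') ha hb hab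
    (nMatrix_convexCombo_le hW ha hb hab h₁ h₂ hθ')

lemma log_pfEigenvalue_kMatrix_convexCombo_le (hM : (marginal W).IsIrreducible)
    (hW : ∀ s s', 0 ≤ W s s') (ha : 0 < a) (hb : 0 < b) (hab : a + b = 1) (h₁ : -1 < θ₁)
    (h₂ : -1 < θ₂) :
    (1 + (a * θ₁ + b * θ₂)) * Real.log (pfEigenvalue (kMatrix W (a * θ₁ + b * θ₂))) ≤
      a * ((1 + θ₁) * Real.log (pfEigenvalue (kMatrix W θ₁))) +
        b * ((1 + θ₂) * Real.log (pfEigenvalue (kMatrix W θ₂))) := by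
  have hr : 0 < 1 + (a * θ₁ + b * θ₂) := by nlinarith
  have hle := log_pfEigenvalue_le_add (isIrreducible_kMatrix hM hW h₁)
    (isIrreducible_kMatrix hM hW h₂) (isIrreducible_kMatrix hM hW (by linarith))
    (div_pos (mul_pos ha (by linarith)) hr) (div_pos (mul_pos hb (by linarith)) hr)
    (by rw [← add_div, div_eq_one_iff_eq hr.ne']; linear_combination hab)
    (kMatrix_convexCombo_le hW ha hb hab h₁ h₂)
  refine (mul_le_mul_of_nonneg_left hle hr.le).trans_eq ?_
  field_simp

lemma convexOn_log_pfEigenvalue_nMatrix (hM : (marginal W).IsIrreducible)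
    (hW : ∀ s s', 0 ≤ W s s') (hθ' : -1 < θ') :
    ConvexOn ℝ (Ioi (-1)) fun θ => Real.log (pfEigenvalue (nMatrix W θ θ')) :=
  convexOn_iff_forall_pos.2 ⟨convex_Ioi _, fun _ h₁ _ h₂ _ _ ha hb hab =>
    log_pfEigenvalue_nMatrix_convexCombo_le hM hW ha hb hab h₁ h₂ hθ'⟩

lemma convexOn_log_pfEigenvalue_kMatrix (hM : (marginal W).IsIrreducible)
    (hW : ∀ s s', 0 ≤ W s s') :
    ConvexOn ℝ (Ioi (-1)) fun θ => (1 + θ) * Real.log (pfEigenvalue (kMatrix W θ)) :=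
  convexOn_iff_forall_pos.2 ⟨convex_Ioi _, fun _ h₁ _ h₂ _ _ ha hb hab =>
    log_pfEigenvalue_kMatrix_convexCombo_le hM hW ha hb hab h₁ h₂⟩

lemma StronglyNonHidden.exists_hasPotential_of_nMatrix (snh : StronglyNonHidden W)
    (hM : (marginal W).IsIrreducible) (hW : ∀ s s', 0 ≤ W s s') (ha : 0 < a) (hb : 0 < b)
    (hab : a + b = 1) (h₁ : -1 < θ₁) (h₂ : -1 < θ₂) (hne : θ₁ ≠ θ₂) (hθ' : -1 < θ')
    (h : Real.log (pfEigenvalue (nMatrix W (a * θ₁ + b * θ₂) θ')) =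
      a * Real.log (pfEigenvalue (nMatrix W θ₁ θ')) +
        b * Real.log (pfEigenvalue (nMatrix W θ₂ θ'))) :
    ∃ ℓ, HasPotential W ℓ ∧ IsConstAddCoboundary (marginal W) ℓ := by
  obtain ⟨hentries, c, g, hconj⟩ := exists_eq_diagConj_of_log_pfEigenvalue_eq_add
    (isIrreducible_nMatrix hM hW h₁ hθ') (isIrreducible_nMatrix hM hW h₂ hθ')
    (isIrreducible_nMatrix hM hW (by nlinarith) hθ') ha hb hab
    (nMatrix_convexCombo_le hW ha hb hab h₁ h₂ hθ') h
  obtain ⟨ℓ, hℓ⟩ := snh.exists_hasPotential hW ha hb hab h₁ h₂ hne fun y y' =>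
    powerMarginal_convexCombo_eq_of_nMatrix hW ha hb hab h₁ h₂ hθ' (hentries y y')
  rw [hℓ.nMatrix_eq_expTilt hW h₁ hθ', hℓ.nMatrix_eq_expTilt hW h₂ hθ'] at hconj
  refine ⟨ℓ, hℓ, isConstAddCoboundary_of_expTilt_eq_diagConj ?_ hconj⟩
  rwa [Ne, div_left_inj' (by linarith : 1 + θ' ≠ 0)]

lemma StronglyNonHidden.exists_hasPotential_of_kMatrix (snh : StronglyNonHidden W)
    (hM : (marginal W).IsIrreducible) (hW : ∀ s s', 0 ≤ W s s') (ha : 0 < a) (hb : 0 < b)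
    (hab : a + b = 1) (h₁ : -1 < θ₁) (h₂ : -1 < θ₂) (hne : θ₁ ≠ θ₂)
    (h : (1 + (a * θ₁ + b * θ₂)) * Real.log (pfEigenvalue (kMatrix W (a * θ₁ + b * θ₂))) =
      a * ((1 + θ₁) * Real.log (pfEigenvalue (kMatrix W θ₁))) +
        b * ((1 + θ₂) * Real.log (pfEigenvalue (kMatrix W θ₂)))) :
    ∃ ℓ, HasPotential W ℓ ∧ IsConstAddCoboundary (marginal W) ℓ := by
  have hr : 0 < 1 + (a * θ₁ + b * θ₂) := by nlinarith
  have h₁' : 1 + θ₁ ≠ 0 := by linarith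
  have h₂' : 1 + θ₂ ≠ 0 := by linarith
  obtain ⟨hentries, c, g, hconj⟩ := exists_eq_diagConj_of_log_pfEigenvalue_eq_add
    (isIrreducible_kMatrix hM hW h₁) (isIrreducible_kMatrix hM hW h₂)
    (isIrreducible_kMatrix hM hW (by linarith))
    (div_pos (mul_pos ha (by linarith)) hr) (div_pos (mul_pos hb (by linarith)) hr)
    (by rw [← add_div, div_eq_one_iff_eq hr.ne']; linear_combination hab)
    (kMatrix_convexCombo_le hW ha hb hab h₁ h₂)
    (mul_left_cancel₀ hr.ne' (h.trans (by field_simp)))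
  obtain ⟨ℓ, hℓ⟩ := snh.exists_hasPotential hW ha hb hab h₁ h₂ hne fun y y' =>
    powerMarginal_convexCombo_eq_of_kMatrix hW ha hb hab h₁ h₂ (hentries y y')
  rw [hℓ.kMatrix_eq_expTilt hW h₁, hℓ.kMatrix_eq_expTilt hW h₂] at hconj
  refine ⟨ℓ, hℓ, isConstAddCoboundary_of_expTilt_eq_diagConj (fun heq => hne ?_) hconj⟩
  rw [div_eq_div_iff h₁' h₂'] at heq
  linear_combination heq

lemma StronglyNonHidden.strictConvexOn_log_pfEigenvalue_nMatrix (snh : StronglyNonHidden W)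
    (hirr : W.IsIrreducible) (hf : ¬IsConstAddCoboundary W (increment W)) (hθ' : -1 < θ') :
    StrictConvexOn ℝ (Ioi (-1)) fun θ => Real.log (pfEigenvalue (nMatrix W θ θ')) := by
  have hM := snh.nonHidden.isIrreducible_marginal hirr
  refine ⟨convex_Ioi _, fun θ₁ h₁ θ₂ h₂ hne a b ha hb hab => lt_of_le_of_ne
    (log_pfEigenvalue_nMatrix_convexCombo_le hM hirr.nonneg ha hb hab h₁ h₂ hθ') fun heq => hf ?_⟩
  obtain ⟨ℓ, hℓ, hcob⟩ :=
    snh.exists_hasPotential_of_nMatrix hM hirr.nonneg ha hb hab h₁ h₂ hne hθ' heq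
  exact hℓ.isConstAddCoboundary_increment snh.nonHidden hirr.nonneg hcob

lemma StronglyNonHidden.strictConvexOn_log_pfEigenvalue_kMatrix (snh : StronglyNonHidden W)
    (hirr : W.IsIrreducible) (hf : ¬IsConstAddCoboundary W (increment W)) :
    StrictConvexOn ℝ (Ioi (-1)) fun θ => (1 + θ) * Real.log (pfEigenvalue (kMatrix W θ)) := by
  have hM := snh.nonHidden.isIrreducible_marginal hirr
  refine ⟨convex_Ioi _, fun θ₁ h₁ θ₂ h₂ hne a b ha hb hab => lt_of_le_of_ne
    (log_pfEigenvalue_kMatrix_convexCombo_le hM hirr.nonneg ha hb hab h₁ h₂) fun heq => hf ?_⟩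
  obtain ⟨ℓ, hℓ, hcob⟩ := snh.exists_hasPotential_of_kMatrix hM hirr.nonneg ha hb hab h₁ h₂ hne heq
  exact hℓ.isConstAddCoboundary_increment snh.nonHidden hirr.nonneg hcob

variable [DecidableEq X]

lemma log_pfEigenvalue_kMatrix_zero (hW : W ∈ colStochastic ℝ (X × Y)) :
    Real.log (pfEigenvalue (kMatrix W 0)) = 0 := by
  rw [kMatrix_zero, log_pfEigenvalue_of_mem_colStochastic (marginal_mem_colStochastic hW)]

lemma log_pfEigenvalue_nMatrix_zero (hW : W ∈ colStochastic ℝ (X × Y)) (θ' : ℝ) :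
    Real.log (pfEigenvalue (nMatrix W 0 θ')) = 0 := by
  rw [nMatrix_zero, log_pfEigenvalue_of_mem_colStochastic (marginal_mem_colStochastic hW)]

lemma StronglyNonHidden.pfEigenvalue_tilted_eq (snh : StronglyNonHidden W)
    (hirr : W.IsIrreducible) (hθ : -1 < θ) :
    pfEigenvalue (tilted W θ) = pfEigenvalue (nMatrix W θ 0) := by
  refine pfEigenvalue_eq_of_sum_fiber (π := Prod.snd)
    (fun s s' => mul_nonneg (Real.rpow_nonneg (hirr.nonneg s s') _)
      (Real.rpow_nonneg (marginal_nonneg hirr.nonneg _ _) _))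
    (isIrreducible_nMatrix (snh.nonHidden.isIrreducible_marginal hirr) hirr.nonneg hθ
      neg_one_lt_zero) fun y ⟨x', y'⟩ => ?_
  calc ∑ s : X × Y with s.2 = y, tilted W θ s (x', y')
      = ∑ x, tilted W θ (x, y) (x', y') := by
        rw [Finset.sum_filter, Fintype.sum_prod_type]
        simp only [Finset.sum_ite_eq', Finset.mem_univ, if_true]
    _ = nMatrix W θ 0 y y' := by
        simp only [tilted, of_apply]
        rw [← Finset.sum_mul, snh.sum_eq_powerMarginal hθ, nMatrix_eq_mul_kMatrix_rpow hirr.nonneg,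
          kMatrix_zero]

lemma StronglyNonHidden.exists_hasPotential_of_isConstAddCoboundary (snh : StronglyNonHidden W)
    (hirr : W.IsIrreducible) (hW : W ∈ colStochastic ℝ (X × Y))
    (hf : IsConstAddCoboundary W (increment W)) :
    ∃ ℓ, HasPotential W ℓ ∧ IsConstAddCoboundary (marginal W) ℓ := by
  obtain ⟨c, hc⟩ := snh.nonHidden.exists_log_pfEigenvalue_tilted_eq hirr hW hf
  have hlin (θ : ℝ) (hθ : -1 < θ) : Real.log (pfEigenvalue (nMatrix W θ 0)) = θ * c := by
    rw [← snh.pfEigenvalue_tilted_eq hirr hθ, hc θ hθ]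
  refine snh.exists_hasPotential_of_nMatrix (a := 1 / 2) (b := 1 / 2) (θ₁ := 0) (θ₂ := 1)
    (snh.nonHidden.isIrreducible_marginal hirr) hirr.nonneg (by norm_num) (by norm_num)
    (by norm_num) neg_one_lt_zero (by norm_num) (by norm_num) neg_one_lt_zero ?_
  rw [hlin _ (by norm_num), hlin 0 neg_one_lt_zero, hlin 1 (by norm_num)]
  ring

lemma StronglyNonHidden.exists_log_pfEigenvalue_nMatrix_eq (snh : StronglyNonHidden W)
    (hirr : W.IsIrreducible) (hW : W ∈ colStochastic ℝ (X × Y))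
    (hf : IsConstAddCoboundary W (increment W)) (hθ' : -1 < θ') :
    ∃ c : ℝ, ∀ θ, -1 < θ → Real.log (pfEigenvalue (nMatrix W θ θ')) = θ * c := by
  obtain ⟨ℓ, hℓ, hcob⟩ := snh.exists_hasPotential_of_isConstAddCoboundary hirr hW hf
  obtain ⟨c, hc⟩ := hcob.exists_log_pfEigenvalue_eq (snh.nonHidden.isIrreducible_marginal hirr)
  refine ⟨c / (1 + θ'), fun θ hθ => ?_⟩
  rw [hℓ.nMatrix_eq_expTilt hirr.nonneg hθ hθ', hc,
    log_pfEigenvalue_of_mem_colStochastic (marginal_mem_colStochastic hW), add_zero, div_mul_comm,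
    mul_comm]

lemma StronglyNonHidden.exists_log_pfEigenvalue_kMatrix_eq (snh : StronglyNonHidden W)
    (hirr : W.IsIrreducible) (hW : W ∈ colStochastic ℝ (X × Y))
    (hf : IsConstAddCoboundary W (increment W)) :
    ∃ c : ℝ, ∀ θ, -1 < θ → (1 + θ) * Real.log (pfEigenvalue (kMatrix W θ)) = θ * c := by
  obtain ⟨ℓ, hℓ, hcob⟩ := snh.exists_hasPotential_of_isConstAddCoboundary hirr hW hf
  obtain ⟨c, hc⟩ := hcob.exists_log_pfEigenvalue_eq (snh.nonHidden.isIrreducible_marginal hirr)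
  refine ⟨c, fun θ hθ => ?_⟩
  rw [hℓ.kMatrix_eq_expTilt hirr.nonneg hθ, hc,
    log_pfEigenvalue_of_mem_colStochastic (marginal_mem_colStochastic hW), add_zero, ← mul_assoc,
    mul_div_cancel₀ _ (by linarith)]

end SpectralConvexity

section Differentiability

open Matrix

lemma exists_hasDerivAt_log_pfEigenvalue {n : Type*} [Fintype n] [DecidableEq n] [Nonempty n]
    {A₀ : Matrix n n ℝ} (hA₀ : A₀.IsIrreducible) (A' : Matrix n n ℝ) :
    ∃ d : ℝ, ∀ (A : ℝ → Matrix n n ℝ) (t₀ : ℝ), A t₀ = A₀ → (∀ᶠ t in 𝓝 t₀, (A t).IsIrreducible) →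
      (∀ i j, HasDerivAt (fun t => A t i j) (A' i j) t₀) →
      HasDerivAt (fun t => Real.log (pfEigenvalue (A t))) d t₀ := by
  obtain ⟨v, hv, hAv⟩ := exists_pos_mulVec_eq_pfEigenvalue hA₀
  obtain ⟨u, hu, hAu⟩ := exists_pos_vecMul_eq_pfEigenvalue hA₀
  refine ⟨u ⬝ᵥ (A' *ᵥ v) / (u ⬝ᵥ v) / pfEigenvalue A₀, fun A t₀ h₀ hA hA' => ?_⟩
  subst h₀
  exact (hasDerivAt_pfEigenvalue hu hv hAu hAv hA hA').log (pfEigenvalue_pos hA₀).ne'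

lemma differentiableAt_log_pfEigenvalue {n : Type*} [Fintype n] [DecidableEq n] [Nonempty n]
    {A : ℝ → Matrix n n ℝ} {t₀ : ℝ} (hA : ∀ᶠ t in 𝓝 t₀, (A t).IsIrreducible)
    (hA' : ∀ i j, DifferentiableAt ℝ (fun t => A t i j) t₀) :
    DifferentiableAt ℝ (fun t => Real.log (pfEigenvalue (A t))) t₀ := by
  obtain ⟨d, hd⟩ := exists_hasDerivAt_log_pfEigenvalue hA.self_of_nhds
    (of fun i j => deriv (fun t => A t i j) t₀)
  exact (hd A t₀ rfl hA fun i j => (hA' i j).hasDerivAt).differentiableAt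

variable {X Y : Type*} [Fintype X] [Nonempty X] {W : Matrix (X × Y) (X × Y) ℝ} {θ θ' : ℝ}

lemma differentiableAt_rpow_one_add {w : ℝ} (hw : 0 ≤ w) (hθ : -1 < θ) :
    DifferentiableAt ℝ (fun t => w ^ (1 + t)) θ := by
  rcases hw.eq_or_lt with rfl | hw
  · refine (differentiableAt_const 0).congr_of_eventuallyEq ?_
    filter_upwards [eventually_gt_nhds hθ] with t ht
    rw [Real.zero_rpow (by linarith)]
  · exact (differentiableAt_const w).rpow (differentiableAt_id.const_add 1) hw.ne'

lemma differentiableAt_powerMarginal (hW : ∀ s s', 0 ≤ W s s') (hθ : -1 < θ) (y y' : Y) :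
    DifferentiableAt ℝ (fun t => powerMarginal W t y y') θ :=
  DifferentiableAt.fun_sum fun _ _ => differentiableAt_rpow_one_add (hW _ _) hθ

lemma differentiableAt_kMatrix (hW : ∀ s s', 0 ≤ W s s') (hθ : -1 < θ) (y y' : Y) :
    DifferentiableAt ℝ (fun t => kMatrix W t y y') θ := by
  rcases (marginal_nonneg hW y y').eq_or_lt with h | h
  · refine (differentiableAt_const 0).congr_of_eventuallyEq ?_
    filter_upwards [eventually_gt_nhds hθ] with t ht
    exact kMatrix_eq_zero hW ht h.symm
  · exact (differentiableAt_powerMarginal hW hθ y y').rpow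
      ((differentiableAt_const 1).div (differentiableAt_id.const_add 1) (by linarith : 1 + θ ≠ 0))
      ((powerMarginal_pos_iff hW hθ).2 h).ne'

lemma differentiableAt_nMatrix_left (hW : ∀ s s', 0 ≤ W s s') (hθ : -1 < θ) (hθ' : -1 < θ')
    (y y' : Y) : DifferentiableAt ℝ (fun t => nMatrix W t θ' y y') θ := by
  rcases (marginal_nonneg hW y y').eq_or_lt with h | h
  · refine (differentiableAt_const 0).congr_of_eventuallyEq ?_
    filter_upwards [eventually_gt_nhds hθ] with t ht
    exact nMatrix_eq_zero hW ht θ' h.symm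
  · simp only [nMatrix_eq_mul_kMatrix_rpow hW]
    exact (differentiableAt_powerMarginal hW hθ y y').mul ((differentiableAt_const _).rpow
      differentiableAt_id.neg ((kMatrix_pos_iff hW hθ').2 h).ne')

lemma differentiableAt_nMatrix_right (hW : ∀ s s', 0 ≤ W s s') (hθ : -1 < θ) (hθ' : -1 < θ')
    (y y' : Y) : DifferentiableAt ℝ (fun t => nMatrix W θ t y y') θ' := by
  rcases (marginal_nonneg hW y y').eq_or_lt with h | h
  · simp only [nMatrix_eq_zero hW hθ _ h.symm]
    exact differentiableAt_const 0
  · simp only [nMatrix_eq_mul_kMatrix_rpow hW]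
    exact ((differentiableAt_kMatrix hW hθ' y y').rpow (differentiableAt_const _)
      ((kMatrix_pos_iff hW hθ').2 h).ne').const_mul _

lemma hasDerivAt_nMatrix_zero (hW : ∀ s s', 0 ≤ W s s') (y y' : Y) :
    HasDerivAt (fun t => nMatrix W t 0 y y') (deriv (fun t => kMatrix W t y y') 0) 0 := by
  have hK := (differentiableAt_kMatrix hW neg_one_lt_zero y y').hasDerivAt
  rcases (marginal_nonneg hW y y').eq_or_lt with h | h
  · refine hK.congr_of_eventuallyEq ?_
    filter_upwards [eventually_gt_nhds neg_one_lt_zero] with t ht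
    rw [nMatrix_eq_zero hW ht 0 h.symm, kMatrix_eq_zero hW ht h.symm]
  · have hpos : 0 < kMatrix W 0 y y' := (kMatrix_pos_iff hW neg_one_lt_zero).2 h
    have hprod := (hK.rpow ((hasDerivAt_id (0 : ℝ)).const_add 1) hpos).mul
      ((hasDerivAt_const 0 (kMatrix W 0 y y')).rpow (hasDerivAt_id (0 : ℝ)).neg hpos)
    refine (hprod.congr_of_eventuallyEq ?_).congr_deriv ?_
    · filter_upwards [eventually_gt_nhds neg_one_lt_zero] with t ht
      exact nMatrix_eq_kMatrix_rpow_mul hW ht 0 y y'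
    · simp

variable [Fintype Y] [DecidableEq Y] [Nonempty Y]

lemma differentiableAt_log_pfEigenvalue_kMatrix (hM : (marginal W).IsIrreducible)
    (hW : ∀ s s', 0 ≤ W s s') (hθ : -1 < θ) :
    DifferentiableAt ℝ (fun t => Real.log (pfEigenvalue (kMatrix W t))) θ :=
  differentiableAt_log_pfEigenvalue
    ((eventually_gt_nhds hθ).mono fun _ ht => isIrreducible_kMatrix hM hW ht)
    (differentiableAt_kMatrix hW hθ)

lemma differentiableAt_log_pfEigenvalue_nMatrix_left (hM : (marginal W).IsIrreducible)
    (hW : ∀ s s', 0 ≤ W s s') (hθ : -1 < θ) (hθ' : -1 < θ') :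
    DifferentiableAt ℝ (fun t => Real.log (pfEigenvalue (nMatrix W t θ'))) θ :=
  differentiableAt_log_pfEigenvalue
    ((eventually_gt_nhds hθ).mono fun _ ht => isIrreducible_nMatrix hM hW ht hθ')
    (differentiableAt_nMatrix_left hW hθ hθ')

lemma differentiableAt_log_pfEigenvalue_nMatrix_right (hM : (marginal W).IsIrreducible)
    (hW : ∀ s s', 0 ≤ W s s') (hθ : -1 < θ) (hθ' : -1 < θ') :
    DifferentiableAt ℝ (fun t => Real.log (pfEigenvalue (nMatrix W θ t))) θ' :=
  differentiableAt_log_pfEigenvalue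
    ((eventually_gt_nhds hθ').mono fun _ ht => isIrreducible_nMatrix hM hW hθ ht)
    (differentiableAt_nMatrix_right hW hθ hθ')

lemma exists_hasDerivAt_log_pfEigenvalue_kMatrix_nMatrix (hM : (marginal W).IsIrreducible)
    (hW : ∀ s s', 0 ≤ W s s') :
    ∃ d, HasDerivAt (fun t => Real.log (pfEigenvalue (kMatrix W t))) d 0 ∧
      HasDerivAt (fun t => Real.log (pfEigenvalue (nMatrix W t 0))) d 0 := by
  have hev := eventually_gt_nhds (neg_one_lt_zero (R := ℝ))
  obtain ⟨d, hd⟩ := exists_hasDerivAt_log_pfEigenvalue hM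
    (of fun y y' => deriv (fun t => kMatrix W t y y') 0)
  exact ⟨d, hd (kMatrix W) 0 (kMatrix_zero W)
      (hev.mono fun _ ht => isIrreducible_kMatrix hM hW ht)
      fun y y' => (differentiableAt_kMatrix hW neg_one_lt_zero y y').hasDerivAt,
    hd (fun t => nMatrix W t 0) 0 (nMatrix_zero W 0)
      (hev.mono fun _ ht => isIrreducible_nMatrix hM hW ht neg_one_lt_zero)
      (hasDerivAt_nMatrix_zero hW)⟩

end Differentiability

section UpperEntropy

open Matrix

variable {X Y : Type*} [Fintype X] [Nonempty X] {W : Matrix (X × Y) (X × Y) ℝ} {θ : ℝ}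

lemma powerMarginal_le_card (hW : ∀ s s', 0 ≤ W s s') (hW1 : ∀ s s', W s s' ≤ 1) (hθ : -1 < θ)
    (y y' : Y) : powerMarginal W θ y y' ≤ Fintype.card X := by
  refine (Finset.sum_le_card_nsmul Finset.univ _ 1 fun x _ =>
    Real.rpow_le_one (hW _ _) (hW1 _ _) (by linarith)).trans_eq ?_
  rw [nsmul_one, Finset.card_univ]

variable [Fintype Y] [DecidableEq Y]

lemma upperEntropy_eq_entropyOf (W : Matrix (X × Y) (X × Y) ℝ) :
    upperEntropy W = entropyOf fun θ => (1 + θ) * Real.log (pfEigenvalue (kMatrix W θ)) := by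
  have hf : (fun t : ℝ => -((1 + t) / t) * Real.log (pfEigenvalue (kMatrix W t))) =
      fun t => -(1 / t) * ((1 + t) * Real.log (pfEigenvalue (kMatrix W t))) := by
    ext t
    ring
  funext θ
  simp only [upperEntropy, entropyOf, hf]
  ring_nf

lemma upperEntropy_of_ne (hθ : -1 < θ) (h0 : θ ≠ 0) :
    upperEntropy W θ = -(1 / θ) * ((1 + θ) * Real.log (pfEigenvalue (kMatrix W θ))) := by
  rw [upperEntropy_eq_entropyOf, entropyOf_of_ne h0 hθ.ne']

variable [Nonempty Y]

lemma one_add_mul_log_pfEigenvalue_kMatrix_le (hM : (marginal W).IsIrreducible)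
    (hW : ∀ s s', 0 ≤ W s s') (hW1 : ∀ s s', W s s' ≤ 1) (hθ : -1 < θ) (hθ0 : θ < 0) :
    (1 + θ) * Real.log (pfEigenvalue (kMatrix W θ)) ≤
      Real.log (Fintype.card Y) + Real.log (Fintype.card X) := by
  have hr : 0 < 1 + θ := by linarith
  have hX : (0 : ℝ) < Fintype.card X := Nat.cast_pos.2 Fintype.card_pos
  have hlog := log_pfEigenvalue_le_log_card_mul (isIrreducible_kMatrix hM hW hθ) fun y y' =>
    Real.rpow_le_rpow (powerMarginal_nonneg hW θ y y') (powerMarginal_le_card hW hW1 hθ y y')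
      (one_div_nonneg.2 hr.le)
  rw [Real.log_mul (Nat.cast_ne_zero.2 Fintype.card_ne_zero) (by positivity),
    Real.log_rpow hX] at hlog
  calc (1 + θ) * Real.log (pfEigenvalue (kMatrix W θ))
      ≤ (1 + θ) * (Real.log (Fintype.card Y) + 1 / (1 + θ) * Real.log (Fintype.card X)) :=
        mul_le_mul_of_nonneg_left hlog hr.le
    _ = (1 + θ) * Real.log (Fintype.card Y) + Real.log (Fintype.card X) := by field_simp
    _ ≤ Real.log (Fintype.card Y) + Real.log (Fintype.card X) :=
        add_le_add_left (mul_le_of_le_one_left (Real.log_natCast_nonneg _) (by linarith)) _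

variable [DecidableEq X]

lemma one_add_mul_log_pfEigenvalue_kMatrix_zero (hW : W ∈ colStochastic ℝ (X × Y)) :
    (1 + 0) * Real.log (pfEigenvalue (kMatrix W 0)) = 0 := by
  rw [log_pfEigenvalue_kMatrix_zero hW, mul_zero]

lemma hasDerivAt_one_add_mul_log_pfEigenvalue_kMatrix (hW : W ∈ colStochastic ℝ (X × Y)) {d : ℝ}
    (hd : HasDerivAt (fun θ => Real.log (pfEigenvalue (kMatrix W θ))) d 0) :
    HasDerivAt (fun θ => (1 + θ) * Real.log (pfEigenvalue (kMatrix W θ))) d 0 := by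
  refine (((hasDerivAt_id (0 : ℝ)).const_add 1).mul hd).congr_deriv ?_
  simp only [id_eq, log_pfEigenvalue_kMatrix_zero hW, mul_zero, add_zero, zero_add, one_mul]

lemma StronglyNonHidden.exists_hasDerivAt_upperEntropy (snh : StronglyNonHidden W)
    (hirr : W.IsIrreducible) (hW : W ∈ colStochastic ℝ (X × Y)) :
    ∃ d, HasDerivAt (fun θ => (1 + θ) * Real.log (pfEigenvalue (kMatrix W θ))) d 0 :=
  ⟨_, hasDerivAt_one_add_mul_log_pfEigenvalue_kMatrix hW
    (differentiableAt_log_pfEigenvalue_kMatrix (snh.nonHidden.isIrreducible_marginal hirr)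
      hirr.nonneg neg_one_lt_zero).hasDerivAt⟩

lemma StronglyNonHidden.tendsto_upperEntropy_zero (snh : StronglyNonHidden W)
    (hirr : W.IsIrreducible) (hW : W ∈ colStochastic ℝ (X × Y)) :
    Tendsto (upperEntropy W) (𝓝[≠] 0) (𝓝 (upperEntropy W 0)) := by
  obtain ⟨d, hd⟩ := snh.exists_hasDerivAt_upperEntropy hirr hW
  rw [upperEntropy_eq_entropyOf]
  exact (continuousAt_entropyOf_zero
    (one_add_mul_log_pfEigenvalue_kMatrix_zero hW) hd).continuousWithinAt

lemma StronglyNonHidden.isEntropyCurve_upperEntropy_Ioi (snh : StronglyNonHidden W)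
    (hirr : W.IsIrreducible) (hW : W ∈ colStochastic ℝ (X × Y)) :
    IsEntropyCurve (Ioi (-1)) (upperEntropy W) (0 < condVariance W) := by
  obtain ⟨d, hd⟩ := snh.exists_hasDerivAt_upperEntropy hirr hW
  rw [snh.nonHidden.condVariance_pos_iff hirr hW, upperEntropy_eq_entropyOf]
  exact isEntropyCurve_entropyOf (one_add_mul_log_pfEigenvalue_kMatrix_zero hW) hd
    (convexOn_log_pfEigenvalue_kMatrix (snh.nonHidden.isIrreducible_marginal hirr) hirr.nonneg)
    (snh.strictConvexOn_log_pfEigenvalue_kMatrix hirr)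
    fun hf => snh.exists_log_pfEigenvalue_kMatrix_eq hirr hW (not_not.1 hf)

lemma StronglyNonHidden.tendsto_upperEntropy_neg_one (snh : StronglyNonHidden W)
    (hirr : W.IsIrreducible) (hW : W ∈ colStochastic ℝ (X × Y)) :
    Tendsto (upperEntropy W) (𝓝[>] (-1)) (𝓝 (upperEntropy W (-1))) := by
  have hanti := (snh.isEntropyCurve_upperEntropy_Ioi hirr hW).antitoneOn
  rw [upperEntropy_eq_entropyOf] at hanti ⊢
  exact tendsto_entropyOf_neg_one (one_add_mul_log_pfEigenvalue_kMatrix_zero hW) hanti fun _ =>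
    one_add_mul_log_pfEigenvalue_kMatrix_le (snh.nonHidden.isIrreducible_marginal hirr)
      hirr.nonneg fun _ _ => le_one_of_mem_colStochastic hW

theorem StronglyNonHidden.isEntropyCurve_upperEntropy (snh : StronglyNonHidden W)
    (hirr : W.IsIrreducible) (hW : W ∈ colStochastic ℝ (X × Y)) :
    IsEntropyCurve (Ici (-1)) (upperEntropy W) (0 < condVariance W) :=
  (snh.isEntropyCurve_upperEntropy_Ioi hirr hW).Ici_of_Ioi
    (snh.tendsto_upperEntropy_neg_one hirr hW)

end UpperEntropy

section TwoParamEntropy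

open Matrix

variable {X Y : Type*} [Fintype X] [Nonempty X] {W : Matrix (X × Y) (X × Y) ℝ} {θ θ' : ℝ}
  [Fintype Y] [DecidableEq Y]

/-- The function `φ` of `θ` for which `H^W_{1 + θ, 1 + θ'}(X|Y) = -φ θ / θ`. -/
noncomputable def twoParamLog (W : Matrix (X × Y) (X × Y) ℝ) (θ' θ : ℝ) : ℝ :=
  Real.log (pfEigenvalue (nMatrix W θ θ')) + θ * Real.log (pfEigenvalue (kMatrix W θ'))

variable [Nonempty Y]

lemma convexOn_twoParamLog (hM : (marginal W).IsIrreducible) (hW : ∀ s s', 0 ≤ W s s')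
    (hθ' : -1 < θ') : ConvexOn ℝ (Ioi (-1)) (twoParamLog W θ') :=
  (convexOn_log_pfEigenvalue_nMatrix hM hW hθ').add
    ((LinearMap.mulRight ℝ (Real.log (pfEigenvalue (kMatrix W θ')))).convexOn (convex_Ioi _))

lemma StronglyNonHidden.strictConvexOn_twoParamLog (snh : StronglyNonHidden W)
    (hirr : W.IsIrreducible) (hf : ¬IsConstAddCoboundary W (increment W)) (hθ' : -1 < θ') :
    StrictConvexOn ℝ (Ioi (-1)) (twoParamLog W θ') :=
  (snh.strictConvexOn_log_pfEigenvalue_nMatrix hirr hf hθ').add_convexOn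
    ((LinearMap.mulRight ℝ (Real.log (pfEigenvalue (kMatrix W θ')))).convexOn (convex_Ioi _))

lemma one_add_mul_log_pfEigenvalue_kMatrix_le_twoParamLog (hM : (marginal W).IsIrreducible)
    (hW : ∀ s s', 0 ≤ W s s') (hθ : 0 < θ) (hθ' : -1 < θ') :
    (1 + θ) * Real.log (pfEigenvalue (kMatrix W θ)) ≤ twoParamLog W θ' θ := by
  have hr : 0 < 1 + θ := by linarith
  have hle := log_pfEigenvalue_le_add (a := 1 / (1 + θ)) (b := θ / (1 + θ))
    (isIrreducible_nMatrix hM hW (by linarith : -1 < θ) hθ') (isIrreducible_kMatrix hM hW hθ')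
    (isIrreducible_kMatrix hM hW (by linarith : -1 < θ)) (by positivity) (by positivity)
    (by field_simp) fun y y' => ?_
  · rw [twoParamLog]
    refine (mul_le_mul_of_nonneg_left hle hr.le).trans_eq ?_
    field_simp
  · rcases (marginal_nonneg hW y y').eq_or_lt with h | h
    · rw [kMatrix_eq_zero hW (by linarith) h.symm]
      exact mul_nonneg (Real.rpow_nonneg (nMatrix_nonneg hW _ _ _ _) _)
        (Real.rpow_nonneg (kMatrix_nonneg hW _ _ _) _)
    · have hK : 0 < kMatrix W θ y y' := (kMatrix_pos_iff hW (by linarith)).2 h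
      have hK' := (kMatrix_pos_iff hW hθ').2 h
      rw [nMatrix_eq_kMatrix_rpow_mul hW (by linarith),
        Real.mul_rpow (by positivity) (by positivity), ← Real.rpow_mul hK.le,
        ← Real.rpow_mul hK'.le, mul_one_div_cancel hr.ne', Real.rpow_one, mul_assoc,
        ← Real.rpow_add hK', mul_one_div, ← add_div, neg_add_cancel, zero_div, Real.rpow_zero,
        mul_one]

lemma twoParamLog_le_one_add_mul_log_pfEigenvalue_kMatrix (hM : (marginal W).IsIrreducible)
    (hW : ∀ s s', 0 ≤ W s s') (hθ : -1 < θ) (hθ0 : θ < 0) (hθ' : -1 < θ') :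
    twoParamLog W θ' θ ≤ (1 + θ) * Real.log (pfEigenvalue (kMatrix W θ)) := by
  have hle := log_pfEigenvalue_le_add (a := 1 + θ) (b := -θ) (isIrreducible_kMatrix hM hW hθ)
    (isIrreducible_kMatrix hM hW hθ') (isIrreducible_nMatrix hM hW hθ hθ') (by linarith)
    (by linarith) (by ring) fun y y' => (nMatrix_eq_kMatrix_rpow_mul hW hθ θ' y y').le
  rw [twoParamLog]
  linarith

variable [DecidableEq X]

lemma twoParamLog_zero (hW : W ∈ colStochastic ℝ (X × Y)) (θ' : ℝ) : twoParamLog W θ' 0 = 0 := by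
  rw [twoParamLog, log_pfEigenvalue_nMatrix_zero hW, zero_mul, add_zero]

lemma div_mul_upperEntropy (hW : W ∈ colStochastic ℝ (X × Y)) (hθ' : -1 < θ') :
    θ' / (1 + θ') * upperEntropy W θ' = -Real.log (pfEigenvalue (kMatrix W θ')) := by
  have h1 : 1 + θ' ≠ 0 := by linarith
  rw [div_mul_eq_mul_div, upperEntropy_eq_entropyOf,
    mul_entropyOf (one_add_mul_log_pfEigenvalue_kMatrix_zero hW) hθ'.ne', ← mul_neg,
    mul_div_cancel_left₀ _ h1]

lemma twoParamEntropy_eq_entropyOf (hW : W ∈ colStochastic ℝ (X × Y)) (hθ' : -1 < θ')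
    (hθ : -1 < θ) : twoParamEntropy W θ θ' = entropyOf (twoParamLog W θ') θ := by
  have hf (t : ℝ) (ht : t ≠ 0) : -(1 / t) * Real.log (pfEigenvalue (nMatrix W t θ')) +
      θ' / (1 + θ') * upperEntropy W θ' = -(1 / t) * twoParamLog W θ' t := by
    rw [div_mul_upperEntropy hW hθ', twoParamLog]
    field_simp
    ring
  rcases eq_or_ne θ 0 with rfl | h0
  · simp only [twoParamEntropy, entropyOf, if_true, limUnder]
    exact congrArg lim (Filter.map_congr (eventually_mem_nhdsWithin.mono hf))
  · rw [entropyOf_of_ne h0 hθ.ne', ← hf θ h0, twoParamEntropy, if_neg h0]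

lemma twoParamEntropy_of_ne (hW : W ∈ colStochastic ℝ (X × Y)) (hθ' : -1 < θ') (hθ : -1 < θ)
    (h0 : θ ≠ 0) : twoParamEntropy W θ θ' = -(1 / θ) * twoParamLog W θ' θ := by
  rw [twoParamEntropy_eq_entropyOf hW hθ' hθ, entropyOf_of_ne h0 hθ.ne']

lemma continuousAt_twoParamEntropy_zero (hM : (marginal W).IsIrreducible)
    (hW : W ∈ colStochastic ℝ (X × Y)) (hθ' : -1 < θ') :
    ContinuousAt (fun θ => twoParamEntropy W θ θ') 0 := by
  have hN := differentiableAt_log_pfEigenvalue_nMatrix_left hM hW.1 neg_one_lt_zero hθ'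
  have hd : DifferentiableAt ℝ (twoParamLog W θ') 0 :=
    hN.add (differentiableAt_id.mul_const _)
  refine (continuousAt_entropyOf_zero (twoParamLog_zero hW θ') hd.hasDerivAt).congr ?_
  filter_upwards [eventually_gt_nhds neg_one_lt_zero] with θ hθ
  exact (twoParamEntropy_eq_entropyOf hW hθ' hθ).symm

lemma StronglyNonHidden.tendsto_twoParamEntropy_zero (snh : StronglyNonHidden W)
    (hirr : W.IsIrreducible) (hW : W ∈ colStochastic ℝ (X × Y)) (hθ' : -1 < θ') :
    Tendsto (fun θ => twoParamEntropy W θ θ') (𝓝[≠] 0) (𝓝 (twoParamEntropy W 0 θ')) :=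
  (continuousAt_twoParamEntropy_zero (snh.nonHidden.isIrreducible_marginal hirr) hW
    hθ').continuousWithinAt

theorem StronglyNonHidden.isEntropyCurve_twoParamEntropy (snh : StronglyNonHidden W)
    (hirr : W.IsIrreducible) (hW : W ∈ colStochastic ℝ (X × Y)) (hθ' : -1 < θ') :
    IsEntropyCurve (Ioi (-1)) (fun θ => twoParamEntropy W θ θ') (0 < condVariance W) := by
  have hM := snh.nonHidden.isIrreducible_marginal hirr
  rw [snh.nonHidden.condVariance_pos_iff hirr hW]
  refine isEntropyCurve_Ioi neg_one_lt_zero (convexOn_twoParamLog hM hirr.nonneg hθ')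
    (fun θ hθ => ?_) (continuousAt_twoParamEntropy_zero hM hW hθ')
    (fun hf => snh.strictConvexOn_twoParamLog hirr hf hθ') fun hf => ?_
  · rw [twoParamEntropy_eq_entropyOf hW hθ' hθ, mul_entropyOf (twoParamLog_zero hW θ') hθ.ne']
  · obtain ⟨c, hc⟩ := snh.exists_log_pfEigenvalue_nMatrix_eq hirr hW (not_not.1 hf) hθ'
    exact ⟨c + Real.log (pfEigenvalue (kMatrix W θ')), fun θ hθ => by
      rw [twoParamLog, hc θ hθ, mul_add]⟩

theorem StronglyNonHidden.twoParamEntropy_zero_eq_lowerEntropy (snh : StronglyNonHidden W)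
    (hirr : W.IsIrreducible) (hW : W ∈ colStochastic ℝ (X × Y)) (hθ : -1 < θ) :
    twoParamEntropy W θ 0 = lowerEntropy W θ := by
  rw [twoParamEntropy_eq_entropyOf hW neg_one_lt_zero hθ]
  refine entropyOf_congr (fun t ht => ?_) hθ
  rw [twoParamLog, log_pfEigenvalue_kMatrix_zero hW, mul_zero, add_zero,
    snh.pfEigenvalue_tilted_eq hirr ht]

theorem StronglyNonHidden.twoParamEntropy_self (snh : StronglyNonHidden W)
    (hirr : W.IsIrreducible) (hW : W ∈ colStochastic ℝ (X × Y)) (hθ : -1 < θ) :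
    twoParamEntropy W θ θ = upperEntropy W θ := by
  rcases eq_or_ne θ 0 with rfl | h0
  · obtain ⟨d, hK, hN⟩ := exists_hasDerivAt_log_pfEigenvalue_kMatrix_nMatrix
      (snh.nonHidden.isIrreducible_marginal hirr) hirr.nonneg
    have hlog : HasDerivAt (twoParamLog W 0) d 0 := by
      refine (hN.add ((hasDerivAt_id 0).mul_const
        (Real.log (pfEigenvalue (kMatrix W 0))))).congr_deriv ?_
      rw [log_pfEigenvalue_kMatrix_zero hW, mul_zero, add_zero]
    rw [twoParamEntropy_eq_entropyOf hW hθ hθ, upperEntropy_eq_entropyOf,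
      entropyOf_zero (twoParamLog_zero hW 0) hlog,
      entropyOf_zero (one_add_mul_log_pfEigenvalue_kMatrix_zero hW)
        (hasDerivAt_one_add_mul_log_pfEigenvalue_kMatrix hW hK)]
  · rw [twoParamEntropy_of_ne hW hθ hθ h0, upperEntropy_of_ne hθ h0, twoParamLog,
      nMatrix_self hirr.nonneg hθ, add_mul, one_mul]

lemma StronglyNonHidden.twoParamEntropy_le_upperEntropy (snh : StronglyNonHidden W)
    (hirr : W.IsIrreducible) (hW : W ∈ colStochastic ℝ (X × Y)) (hθ : -1 < θ) (h0 : θ ≠ 0)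
    (hθ' : -1 < θ') : twoParamEntropy W θ θ' ≤ upperEntropy W θ := by
  have hM := snh.nonHidden.isIrreducible_marginal hirr
  rw [twoParamEntropy_of_ne hW hθ' hθ h0, upperEntropy_of_ne hθ h0]
  rcases h0.lt_or_gt with hneg | hpos
  · exact mul_le_mul_of_nonneg_left
      (twoParamLog_le_one_add_mul_log_pfEigenvalue_kMatrix hM hirr.nonneg hθ hneg hθ')
      (neg_nonneg.2 (one_div_neg.2 hneg).le)
  · exact mul_le_mul_of_nonpos_left
      (one_add_mul_log_pfEigenvalue_kMatrix_le_twoParamLog hM hirr.nonneg hpos hθ')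
      (neg_nonpos.2 (one_div_pos.2 hpos).le)

theorem StronglyNonHidden.lowerEntropy_le_upperEntropy (snh : StronglyNonHidden W)
    (hirr : W.IsIrreducible) (hW : W ∈ colStochastic ℝ (X × Y)) (hθ : -1 < θ) (h0 : θ ≠ 0) :
    lowerEntropy W θ ≤ upperEntropy W θ :=
  (snh.twoParamEntropy_zero_eq_lowerEntropy hirr hW hθ).symm.trans_le
    (snh.twoParamEntropy_le_upperEntropy hirr hW hθ h0 neg_one_lt_zero)

theorem StronglyNonHidden.isMaxOn_twoParamEntropy (snh : StronglyNonHidden W)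
    (hirr : W.IsIrreducible) (hW : W ∈ colStochastic ℝ (X × Y)) (hθ : -1 < θ) (h0 : θ ≠ 0) :
    IsMaxOn (fun θ' => twoParamEntropy W θ θ') (Ioi (-1)) θ := fun _ hθ' =>
  (snh.twoParamEntropy_le_upperEntropy hirr hW hθ h0 hθ').trans_eq
    (snh.twoParamEntropy_self hirr hW hθ).symm

lemma differentiableAt_twoParamEntropy_right (hM : (marginal W).IsIrreducible)
    (hW : W ∈ colStochastic ℝ (X × Y)) (hθ : -1 < θ) (h0 : θ ≠ 0) (hθ' : -1 < θ') :
    DifferentiableAt ℝ (fun t => twoParamEntropy W θ t) θ' := by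
  refine (((differentiableAt_log_pfEigenvalue_nMatrix_right hM hW.1 hθ hθ').add
    ((differentiableAt_log_pfEigenvalue_kMatrix hM hW.1 hθ').const_mul θ)).const_mul
      (-(1 / θ))).congr_of_eventuallyEq ?_
  filter_upwards [eventually_gt_nhds hθ'] with t ht
  exact twoParamEntropy_of_ne hW ht hθ h0

theorem StronglyNonHidden.hasDerivAt_twoParamEntropy_self (snh : StronglyNonHidden W)
    (hirr : W.IsIrreducible) (hW : W ∈ colStochastic ℝ (X × Y)) (hθ : -1 < θ) (h0 : θ ≠ 0) :
    HasDerivAt (fun θ' => twoParamEntropy W θ θ') 0 θ := by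
  have hmax := (snh.isMaxOn_twoParamEntropy hirr hW hθ h0).isLocalMax (Ioi_mem_nhds hθ)
  rw [← hmax.deriv_eq_zero]
  exact (differentiableAt_twoParamEntropy_right (snh.nonHidden.isIrreducible_marginal hirr) hW hθ
    h0 hθ).hasDerivAt

end TwoParamEntropy

end MarkovRenyi

theorem mainTheorem7_general {X Y : Type*} [Fintype X] [DecidableEq X] [Nonempty X]
    [Fintype Y] [DecidableEq Y] [Nonempty Y]
    (W : Matrix (X × Y) (X × Y) ℝ) (hW : W ∈ Matrix.colStochastic ℝ (X × Y))
    (hirr : W.IsIrreducible) :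
    (MarkovRenyi.NonHidden W →
      Tendsto (MarkovRenyi.lowerEntropy W) (𝓝[≠] 0) (𝓝 (MarkovRenyi.condEntropy W)) ∧
      Tendsto (MarkovRenyi.lowerEntropy W) (𝓝[>] (-1)) (𝓝 (MarkovRenyi.lowerEntropy W (-1))) ∧
      Tendsto (MarkovRenyi.varianceQuotient W) (𝓝[≠] 0) (𝓝 (MarkovRenyi.condVariance W)) ∧
      ConcaveOn ℝ (Ici (-1)) (fun θ => θ * MarkovRenyi.lowerEntropy W θ) ∧
      (StrictConcaveOn ℝ (Ici (-1)) (fun θ => θ * MarkovRenyi.lowerEntropy W θ) ↔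
        0 < MarkovRenyi.condVariance W) ∧
      AntitoneOn (MarkovRenyi.lowerEntropy W) (Ici (-1)) ∧
      (StrictAntiOn (MarkovRenyi.lowerEntropy W) (Ici (-1)) ↔
        0 < MarkovRenyi.condVariance W)) ∧
    (MarkovRenyi.StronglyNonHidden W →
      Tendsto (MarkovRenyi.upperEntropy W) (𝓝[≠] 0) (𝓝 (MarkovRenyi.upperEntropy W 0)) ∧
      Tendsto (MarkovRenyi.upperEntropy W) (𝓝[>] (-1)) (𝓝 (MarkovRenyi.upperEntropy W (-1))) ∧
      (∀ θ' : ℝ, -1 < θ' →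
        Tendsto (fun θ => MarkovRenyi.twoParamEntropy W θ θ') (𝓝[≠] 0)
          (𝓝 (MarkovRenyi.twoParamEntropy W 0 θ'))) ∧
      ConcaveOn ℝ (Ici (-1)) (fun θ => θ * MarkovRenyi.upperEntropy W θ) ∧
      (StrictConcaveOn ℝ (Ici (-1)) (fun θ => θ * MarkovRenyi.upperEntropy W θ) ↔
        0 < MarkovRenyi.condVariance W) ∧
      AntitoneOn (MarkovRenyi.upperEntropy W) (Ici (-1)) ∧
      (StrictAntiOn (MarkovRenyi.upperEntropy W) (Ici (-1)) ↔
        0 < MarkovRenyi.condVariance W) ∧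
      (∀ θ : ℝ, -1 < θ → θ ≠ 0 →
        MarkovRenyi.lowerEntropy W θ ≤ MarkovRenyi.upperEntropy W θ) ∧
      (∀ θ' : ℝ, -1 < θ' →
        ConcaveOn ℝ (Ioi (-1)) (fun θ => θ * MarkovRenyi.twoParamEntropy W θ θ') ∧
        (StrictConcaveOn ℝ (Ioi (-1)) (fun θ => θ * MarkovRenyi.twoParamEntropy W θ θ') ↔
          0 < MarkovRenyi.condVariance W) ∧
        AntitoneOn (fun θ => MarkovRenyi.twoParamEntropy W θ θ') (Ioi (-1)) ∧
        (StrictAntiOn (fun θ => MarkovRenyi.twoParamEntropy W θ θ') (Ioi (-1)) ↔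
          0 < MarkovRenyi.condVariance W)) ∧
      (∀ θ : ℝ, -1 < θ →
        MarkovRenyi.twoParamEntropy W θ 0 = MarkovRenyi.lowerEntropy W θ) ∧
      (∀ θ : ℝ, -1 < θ →
        MarkovRenyi.twoParamEntropy W θ θ = MarkovRenyi.upperEntropy W θ) ∧
      (∀ θ : ℝ, -1 < θ → θ ≠ 0 →
        IsMaxOn (fun θ' => MarkovRenyi.twoParamEntropy W θ θ') (Ioi (-1)) θ ∧
        HasDerivAt (fun θ' => MarkovRenyi.twoParamEntropy W θ θ') 0 θ)) := by
  refine ⟨fun nh => ?_, fun snh => ?_⟩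
  · have hcurve := nh.isEntropyCurve_lowerEntropy hirr hW
    exact ⟨nh.tendsto_lowerEntropy_zero hirr hW, nh.tendsto_lowerEntropy_neg_one hirr hW,
      nh.tendsto_varianceQuotient hirr hW, hcurve.concaveOn, hcurve.strictConcaveOn_iff,
      hcurve.antitoneOn, hcurve.strictAntiOn_iff⟩
  · have hcurve := snh.isEntropyCurve_upperEntropy hirr hW
    refine ⟨snh.tendsto_upperEntropy_zero hirr hW, snh.tendsto_upperEntropy_neg_one hirr hW,
      fun _ => snh.tendsto_twoParamEntropy_zero hirr hW, hcurve.concaveOn,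
      hcurve.strictConcaveOn_iff, hcurve.antitoneOn, hcurve.strictAntiOn_iff,
      fun _ => snh.lowerEntropy_le_upperEntropy hirr hW, fun _ hθ' => ?_,
      fun _ => snh.twoParamEntropy_zero_eq_lowerEntropy hirr hW,
      fun _ => snh.twoParamEntropy_self hirr hW, fun _ hθ h0 =>
        ⟨snh.isMaxOn_twoParamEntropy hirr hW hθ h0,
          snh.hasDerivAt_twoParamEntropy_self hirr hW hθ h0⟩⟩
    have hcurve' := snh.isEntropyCurve_twoParamEntropy hirr hW hθ'
    exact ⟨hcurve'.concaveOn, hcurve'.strictConcaveOn_iff, hcurve'.antitoneOn,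
      hcurve'.strictAntiOn_iff⟩

theorem mainTheorem7 {X Y : Type*} [Fintype X] [DecidableEq X] [Nonempty X]
    [Fintype Y] [DecidableEq Y] [Nonempty Y]
    (W : Matrix (X × Y) (X × Y) ℝ) (hW : W ∈ Matrix.colStochastic ℝ (X × Y))
    (hirr : W.IsIrreducible) (herg : MarkovRenyi.IsErgodic W) :
    (MarkovRenyi.NonHidden W →
      -- the limits that define the lower entropy at `θ = 0, -1` and the variance exist
      Tendsto (MarkovRenyi.lowerEntropy W) (𝓝[≠] 0) (𝓝 (MarkovRenyi.condEntropy W)) ∧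
      Tendsto (MarkovRenyi.lowerEntropy W) (𝓝[>] (-1)) (𝓝 (MarkovRenyi.lowerEntropy W (-1))) ∧
      Tendsto (MarkovRenyi.varianceQuotient W) (𝓝[≠] 0) (𝓝 (MarkovRenyi.condVariance W)) ∧
      -- lower entropy: concavity and monotonicity
      ConcaveOn ℝ (Ici (-1)) (fun θ => θ * MarkovRenyi.lowerEntropy W θ) ∧
      (StrictConcaveOn ℝ (Ici (-1)) (fun θ => θ * MarkovRenyi.lowerEntropy W θ) ↔
        0 < MarkovRenyi.condVariance W) ∧
      AntitoneOn (MarkovRenyi.lowerEntropy W) (Ici (-1)) ∧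
      (StrictAntiOn (MarkovRenyi.lowerEntropy W) (Ici (-1)) ↔
        0 < MarkovRenyi.condVariance W)) ∧
    (MarkovRenyi.StronglyNonHidden W →
      -- the limits that define the upper entropy at `θ = 0, -1` and the two-parameter one at
      -- `θ = 0` exist
      Tendsto (MarkovRenyi.upperEntropy W) (𝓝[≠] 0) (𝓝 (MarkovRenyi.upperEntropy W 0)) ∧
      Tendsto (MarkovRenyi.upperEntropy W) (𝓝[>] (-1)) (𝓝 (MarkovRenyi.upperEntropy W (-1))) ∧
      (∀ θ' : ℝ, -1 < θ' →
        Tendsto (fun θ => MarkovRenyi.twoParamEntropy W θ θ') (𝓝[≠] 0)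
          (𝓝 (MarkovRenyi.twoParamEntropy W 0 θ'))) ∧
      -- upper entropy: concavity and monotonicity
      ConcaveOn ℝ (Ici (-1)) (fun θ => θ * MarkovRenyi.upperEntropy W θ) ∧
      (StrictConcaveOn ℝ (Ici (-1)) (fun θ => θ * MarkovRenyi.upperEntropy W θ) ↔
        0 < MarkovRenyi.condVariance W) ∧
      AntitoneOn (MarkovRenyi.upperEntropy W) (Ici (-1)) ∧
      (StrictAntiOn (MarkovRenyi.upperEntropy W) (Ici (-1)) ↔
        0 < MarkovRenyi.condVariance W) ∧
      -- comparison
      (∀ θ : ℝ, -1 < θ → θ ≠ 0 →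
        MarkovRenyi.lowerEntropy W θ ≤ MarkovRenyi.upperEntropy W θ) ∧
      -- two-parameter entropy: concavity and monotonicity in the first parameter
      (∀ θ' : ℝ, -1 < θ' →
        ConcaveOn ℝ (Ioi (-1)) (fun θ => θ * MarkovRenyi.twoParamEntropy W θ θ') ∧
        (StrictConcaveOn ℝ (Ioi (-1)) (fun θ => θ * MarkovRenyi.twoParamEntropy W θ θ') ↔
          0 < MarkovRenyi.condVariance W) ∧
        AntitoneOn (fun θ => MarkovRenyi.twoParamEntropy W θ θ') (Ioi (-1)) ∧
        (StrictAntiOn (fun θ => MarkovRenyi.twoParamEntropy W θ θ') (Ioi (-1)) ↔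
          0 < MarkovRenyi.condVariance W)) ∧
      -- special cases
      (∀ θ : ℝ, -1 < θ →
        MarkovRenyi.twoParamEntropy W θ 0 = MarkovRenyi.lowerEntropy W θ) ∧
      (∀ θ : ℝ, -1 < θ →
        MarkovRenyi.twoParamEntropy W θ θ = MarkovRenyi.upperEntropy W θ) ∧
      -- maximization over the second parameter
      (∀ θ : ℝ, -1 < θ → θ ≠ 0 →
        IsMaxOn (fun θ' => MarkovRenyi.twoParamEntropy W θ θ') (Ioi (-1)) θ ∧
        HasDerivAt (fun θ' => MarkovRenyi.twoParamEntropy W θ θ') 0 θ)) :=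
  mainTheorem7_general W hW hirr
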